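/- Let $a_1,a_2>0$, $\Omega=\,]0,a_1[\times]0,a_2[$, let $\omega\subset\Omega$ be a nonempty open set and $J\in\mathbb N$. Let $X=H^2(\Omega)\cap H^1_0(\Omega)$, let $\chi_\omega\nabla:X\to (H^1(\omega))^2$, $x\mapsto(\nabla x)|_\omega$, be the regional gradient, and let $A=\partial^2/\partial\xi_1^2+\partial^2/\partial\xi_2^2$ in $X$ with domain $D(A)=\{x\in X:\Delta x\in X\}$. For a bounded output operator $C:X\to\mathbb R$, a gain $H\in L(\mathbb R,X)$ and a control operator $B\in L(\mathbb R^p,X)$ consider the diffusion system with homogeneous Dirichlet boundary condition $$x'(t)=Ax(t)+Bu(t),\quad x(0)=x_0,\qquad y(t)=Cx(t) \tag{1}$$ ($B=0$ is allowed) and the system $$z'(t)=Az(t)+Bu(t)-H\,(Cz(t)-y(t)),\quad z(0)=z_0, \tag{2}$$ with $x_0,z_0\in X$, $u\in L^2_{loc}([0,\infty);\mathbb R^p)$ and solutions in the mild sense. Call $H$ a *stabilizing gain* if $A-HC$, with domain $D(A)$, generates a strongly continuous semigroup $(S(t))_{t\ge0}$ on $X$ with $\|\chi_\omega\nabla S(t)\|_{L(X,(H^1(\omega))^2)}\le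 Me^{-\alpha t}$ for all $t\ge0$, for some $M,\alpha>0$. Say that (2) is a *$GA\omega_G$-observer* for (1) if, with $F=A-HC$ and $T=I$: $A$ generates a strongly continuous semigroup and $H$ is stabilizing; $T$ maps $D(A)$ into $D(F)$; there are bounded operators $M:\mathbb R\to(H^1(\omega))^2$ and $N$ on $(H^1(\omega))^2$ with $MC+N\chi_\omega\nabla T=\chi_\omega\nabla$; $TA-FT=HC$ on $D(A)$ and the control operator of (2) equals $TB$; and for all $x_0,z_0,u$ $$\lim_{t\to\infty}\|\chi_\omega\nabla z(t)-\chi_\omega\nabla T x(t)\|_{(H^1(\omega))^2}=0.$$ Let $b=(b_1,b_2)\in\mathbb R^2$. In each of the following cases the formula for $C$ (in which $x$ stands for its continuous representative on $\overline\Omega$) defines a bounded operator on $X$, there is a nonzero stabilizing gain, and for every stabilizing gain $H$ and every $p$ and $B\in L(\mathbb R^p,X)$ the system (2) is a $GA\omega_G$-observer for (1). 1. (Internal point) $b\in\Omega$, $Cx=x(b)$, and $\frac{ib_1}{a_1}\notin\mathbb N$ and $\frac{jb_2}{a_2}\notin\mathbb N$ for all $i,j=1,\dots,J$. 2. (Filament)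 $\sigma=\gamma([0,1])\subset\overline\Omega$ for a $C^1$ curve $\gamma$, $\sigma$ is symmetric about $b$ (invariant under reflection in the point $b$ or in one of the axis-parallel lines through $b$), $Cx=\int_\sigma x f\,ds$ with $f$ integrable on $\sigma$ with respect to arc length (one-dimensional Hausdorff measure) $ds$, and $\frac{ib_1}{a_1}\notin\mathbb N$ and $\frac{jb_2}{a_2}\notin\mathbb N$ for all $i,j=1,\dots,J$. 3. (Boundary point) $b\in\partial\Omega$, $Cx=x(b)$, and $\frac{jb_2}{a_2}\notin\mathbb N$ for all $j=1,\dots,J$. -/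

import Mathlib

open MeasureTheory Filter Topology Set

noncomputable section

namespace RegionalObserver

/-! ### Sobolev spaces on plane domains -/

/-- The Euclidean plane. -/
abbrev Plane := EuclideanSpace ℝ (Fin 2)

/-- The space `L²(Ω)`. -/
abbrev L2 (Ω : Set Plane) := Lp ℝ 2 (volume.restrict Ω)

/-- Test functions on `Ω`: smooth, with compact support contained in `Ω`. -/
structure IsTest (Ω : Set Plane) (φ : Plane → ℝ) : Prop where
  smooth : ContDiff ℝ (⊤ : ℕ∞) φ
  compact : HasCompactSupport φ
  supp : tsupport φ ⊆ Ω

/-- The classical partial derivative in the `i`-th coordinate direction. -/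
def pderiv (i : Fin 2) (φ : Plane → ℝ) (ξ : Plane) : ℝ :=
  fderiv ℝ φ ξ (EuclideanSpace.single i 1)

/-- `v` is the weak `i`-th partial derivative of `u` on `Ω`. -/
def IsWeakDeriv (Ω : Set Plane) (i : Fin 2) (u v : Plane → ℝ) : Prop :=
  ∀ φ, IsTest Ω φ → ∫ ξ in Ω, pderiv i φ ξ * u ξ = - ∫ ξ in Ω, φ ξ * v ξ

theorem IsTest.pderiv {Ω : Set Plane} {φ : Plane → ℝ} (h : IsTest Ω φ) (i : Fin 2) :
    IsTest Ω (pderiv i φ) where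
  smooth := (h.smooth.fderiv_right (m := (⊤ : ℕ∞)) (by simp)).clm_apply contDiff_const
  compact := h.compact.fderiv_apply (𝕜 := ℝ) _
  supp := (tsupport_fderiv_apply_subset ℝ _).trans h.supp

theorem IsTest.memLp {Ω : Set Plane} {φ : Plane → ℝ} (h : IsTest Ω φ) :
    MemLp φ 2 (volume.restrict Ω) :=
  (h.smooth.continuous.memLp_of_hasCompactSupport h.compact).restrict Ω

theorem IsTest.mono {ω Ω : Set Plane} (h : ω ⊆ Ω) {φ : Plane → ℝ} (hφ : IsTest ω φ) :
    IsTest Ω φ := ⟨hφ.smooth, hφ.compact, hφ.supp.trans h⟩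

theorem integral_test_mul {Ω : Set Plane} {φ : Plane → ℝ} (h : IsTest Ω φ) (u : L2 Ω) :
    ∫ ξ in Ω, φ ξ * u ξ = inner ℝ h.memLp.toLp u := by
  rw [L2.inner_def]
  refine integral_congr_ae ?_
  filter_upwards [h.memLp.coeFn_toLp] with ξ hξ
  simp [hξ, mul_comm]

/-- The Sobolev space `H¹(Ω)` as a subspace of `L²(Ω)³`: an element is the triple of a function of `L²(Ω)` (index `none`)
and of its two weak partial derivatives in `L²(Ω)` (indices `some i`); the norm is
`(‖u‖² + ‖∂₁u‖² + ‖∂₂u‖²)^(1/2)`. -/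
def H1Submodule (Ω : Set Plane) : Submodule ℝ (PiLp 2 fun _ : Option (Fin 2) => L2 Ω) where
  carrier := {w | ∀ i, IsWeakDeriv Ω i (w none) (w (some i))}
  zero_mem' := by
    intro i φ h
    rw [integral_test_mul (h.pderiv i), integral_test_mul h]
    simp
  add_mem' := by
    intro v w hv hw i φ h
    have h1 := hv i φ h
    have h2 := hw i φ h
    rw [integral_test_mul (h.pderiv i), integral_test_mul h] at h1 h2 ⊢
    simp only [PiLp.add_apply, inner_add_right, h1, h2]
    ring
  smul_mem' := by
    intro c w hw i φ h
    have h1 := hw i φ h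
    rw [integral_test_mul (h.pderiv i), integral_test_mul h] at h1 ⊢
    simp only [PiLp.smul_apply, inner_smul_right, h1]
    simp

/-- The Hilbert space `H¹(Ω)`. -/
def H1 (Ω : Set Plane) : Type := H1Submodule Ω

instance (Ω : Set Plane) : NormedAddCommGroup (H1 Ω) :=
  inferInstanceAs (NormedAddCommGroup (H1Submodule Ω))

instance (Ω : Set Plane) : InnerProductSpace ℝ (H1 Ω) :=
  inferInstanceAs (InnerProductSpace ℝ (H1Submodule Ω))

/-- The function underlying an element of `H¹(Ω)`. -/
def H1.val {Ω : Set Plane} : H1 Ω →L[ℝ] L2 Ω :=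
  (PiLp.proj 2 (fun _ : Option (Fin 2) => L2 Ω) none).comp (H1Submodule Ω).subtypeL

/-- The weak partial derivatives of an element of `H¹(Ω)`. -/
def H1.deriv {Ω : Set Plane} (i : Fin 2) : H1 Ω →L[ℝ] L2 Ω :=
  (PiLp.proj 2 (fun _ : Option (Fin 2) => L2 Ω) (some i)).comp (H1Submodule Ω).subtypeL

/-- The space `H¹₀(Ω)`: the closure of the test functions in `H¹(Ω)`. -/
def H10 (Ω : Set Plane) : Submodule ℝ (H1 Ω) :=
  (Submodule.span ℝ
    {w : H1 Ω | ∃ φ, IsTest Ω φ ∧ (H1.val w : Plane → ℝ) =ᵐ[volume.restrict Ω] φ}).topologicalClosure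

/-- The space `(H¹(Ω))²`. -/
abbrev H1Vec (Ω : Set Plane) := PiLp 2 fun _ : Fin 2 => H1 Ω

/-- The space `H²(Ω) ∩ H¹₀(Ω)` as a subspace of `H¹(Ω) × (H¹(Ω))²`: an element is the pair of a function `u ∈ H¹₀(Ω)` and of its
gradient `∇u`, required to lie in `(H¹(Ω))²`; the norm is
`(‖u‖²_{H¹} + ‖∇u‖²_{(H¹)²})^(1/2)`, which is equivalent to the usual `H²` norm. -/
def StateSubmodule (Ω : Set Plane) : Submodule ℝ (WithLp 2 (H1 Ω × H1Vec Ω)) where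
  carrier := {w | w.fst ∈ H10 Ω ∧ ∀ i, H1.val (w.snd i) = H1.deriv i w.fst}
  zero_mem' := ⟨by simp, fun i => by simp⟩
  add_mem' := by
    intro v w hv hw
    exact ⟨by simpa using add_mem hv.1 hw.1, fun i => by simp [hv.2 i, hw.2 i]⟩
  smul_mem' := by
    intro c w hw
    exact ⟨by simpa using (H10 Ω).smul_mem c hw.1, fun i => by simp [hw.2 i]⟩

/-- The state space: the Hilbert space `H²(Ω) ∩ H¹₀(Ω)`. -/
def State (Ω : Set Plane) : Type := StateSubmodule Ω

instance (Ω : Set Plane) : NormedAddCommGroup (State Ω) :=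
  inferInstanceAs (NormedAddCommGroup (StateSubmodule Ω))

instance (Ω : Set Plane) : InnerProductSpace ℝ (State Ω) :=
  inferInstanceAs (InnerProductSpace ℝ (StateSubmodule Ω))

/-- The function underlying a state. -/
def State.val {Ω : Set Plane} : State Ω →L[ℝ] L2 Ω :=
  H1.val.comp ((WithLp.fstL 2 ℝ (H1 Ω) (H1Vec Ω)).comp (StateSubmodule Ω).subtypeL)

/-- The gradient `∇ : H²(Ω) ∩ H¹₀(Ω) → (H¹(Ω))²`. -/
def State.grad {Ω : Set Plane} : State Ω →L[ℝ] H1Vec Ω :=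
  (WithLp.sndL 2 ℝ (H1 Ω) (H1Vec Ω)).comp (StateSubmodule Ω).subtypeL

/-- The (weak) Laplacian `H²(Ω) ∩ H¹₀(Ω) → L²(Ω)`. -/
def State.lap {Ω : Set Plane} : State Ω →L[ℝ] L2 Ω :=
  ∑ i : Fin 2, (H1.deriv i).comp
    ((PiLp.proj 2 (fun _ : Fin 2 => H1 Ω) i).comp State.grad)

theorem isClosed_H1 (Ω : Set Plane) : IsClosed {w | w ∈ H1Submodule Ω} := by
  have : {w | w ∈ H1Submodule Ω} =
      ⋂ (i : Fin 2) (φ : Plane → ℝ) (h : IsTest Ω φ),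
        {w | inner ℝ (h.pderiv i).memLp.toLp (w none) = - inner ℝ h.memLp.toLp (w (some i))} := by
    ext w
    simp only [mem_iInter, mem_ofPred_eq]
    change (∀ i, IsWeakDeriv Ω i (w none) (w (some i))) ↔ _
    refine forall_congr' fun i => forall_congr' fun φ => forall_congr' fun h => ?_
    rw [integral_test_mul (h.pderiv i), integral_test_mul h]
  rw [this]
  refine isClosed_iInter fun i => isClosed_iInter fun φ => isClosed_iInter fun h => ?_
  have hc : ∀ j, Continuous fun w : PiLp 2 (fun _ : Option (Fin 2) => L2 Ω) => w j :=
    fun j => (PiLp.proj (𝕜 := ℝ) 2 (fun _ : Option (Fin 2) => L2 Ω) j).continuous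
  exact isClosed_eq (continuous_const.inner (hc _)) (continuous_const.inner (hc _)).neg

instance (Ω : Set Plane) : CompleteSpace (H1 Ω) :=
  IsClosed.completeSpace_coe (s := {w | w ∈ H1Submodule Ω}) (hs := isClosed_H1 Ω)

theorem isClosed_State (Ω : Set Plane) : IsClosed {w | w ∈ StateSubmodule Ω} := by
  have h1 : Continuous fun w : WithLp 2 (H1 Ω × H1Vec Ω) => w.fst :=
    (WithLp.fstL 2 ℝ (H1 Ω) (H1Vec Ω)).continuous
  have h2 : ∀ i, Continuous fun w : WithLp 2 (H1 Ω × H1Vec Ω) => w.snd i := fun i =>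
    ((PiLp.proj (𝕜 := ℝ) 2 (fun _ : Fin 2 => H1 Ω) i).comp
      (WithLp.sndL 2 ℝ (H1 Ω) (H1Vec Ω))).continuous
  refine IsClosed.inter (s₁ := {w : WithLp 2 (H1 Ω × H1Vec Ω) | w.fst ∈ H10 Ω}) ?_ ?_
  · exact (Submodule.isClosed_topologicalClosure _).preimage h1
  · change IsClosed {w : WithLp 2 (H1 Ω × H1Vec Ω) | ∀ i, H1.val (w.snd i) = H1.deriv i w.fst}
    simp only [ofPred_forall]
    exact isClosed_iInter fun i => isClosed_eq (H1.val.continuous.comp (h2 i))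
      ((H1.deriv i).continuous.comp h1)

instance (Ω : Set Plane) : CompleteSpace (State Ω) :=
  IsClosed.completeSpace_coe (s := {w | w ∈ StateSubmodule Ω}) (hs := isClosed_State Ω)

/-! ### Restriction to a subregion -/

theorem memLp_restrict {ω Ω : Set Plane} (h : ω ⊆ Ω) (u : L2 Ω) :
    MemLp u 2 (volume.restrict ω) :=
  (Lp.memLp u).mono_measure (Measure.restrict_mono_set volume h)

/-- Restriction `L²(Ω) → L²(ω)`, as a linear map. -/
def restrictL2Linear {ω Ω : Set Plane} (h : ω ⊆ Ω) : L2 Ω →ₗ[ℝ] L2 ω where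
  toFun u := (memLp_restrict h u).toLp
  map_add' u v := by
    rw [← MemLp.toLp_add, MemLp.toLp_eq_toLp_iff]
    exact (Lp.coeFn_add u v).filter_mono (ae_mono (Measure.restrict_mono_set volume h))
  map_smul' c u := by
    rw [RingHom.id_apply, ← MemLp.toLp_const_smul, MemLp.toLp_eq_toLp_iff]
    exact (Lp.coeFn_smul c u).filter_mono (ae_mono (Measure.restrict_mono_set volume h))

theorem norm_restrictL2Linear_le {ω Ω : Set Plane} (h : ω ⊆ Ω) (u : L2 Ω) :
    ‖restrictL2Linear h u‖ ≤ 1 * ‖u‖ := by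
  have h1 : ‖restrictL2Linear h u‖ = (eLpNorm u 2 (volume.restrict ω)).toReal :=
    Lp.norm_toLp _ (memLp_restrict h u)
  rw [one_mul, h1, Lp.norm_def u]
  exact ENNReal.toReal_mono (Lp.memLp u).2.ne
    (eLpNorm_mono_measure _ (Measure.restrict_mono_set volume h))

/-- Restriction `L²(Ω) → L²(ω)`. -/
def restrictL2 {ω Ω : Set Plane} (h : ω ⊆ Ω) : L2 Ω →L[ℝ] L2 ω :=
  (restrictL2Linear h).mkContinuous 1 (norm_restrictL2Linear_le h)

theorem restrictL2_coe {ω Ω : Set Plane} (h : ω ⊆ Ω) (u : L2 Ω) :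
    (restrictL2 h u : Plane → ℝ) =ᵐ[volume.restrict ω] u :=
  MemLp.coeFn_toLp (memLp_restrict h u)

theorem integral_test_restrict {ω Ω : Set Plane} (h : ω ⊆ Ω) {φ : Plane → ℝ}
    (hφ : IsTest ω φ) (u : L2 Ω) :
    ∫ ξ in ω, φ ξ * restrictL2 h u ξ = ∫ ξ in Ω, φ ξ * u ξ := by
  have h0 : ∀ ξ, ξ ∉ ω → φ ξ * u ξ = 0 := fun ξ hξ => by
    rw [image_eq_zero_of_notMem_tsupport (fun h' => hξ (hφ.supp h')), zero_mul]
  have h1 : ∫ ξ in ω, φ ξ * restrictL2 h u ξ = ∫ ξ in ω, φ ξ * u ξ := by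
    refine integral_congr_ae ?_
    filter_upwards [restrictL2_coe h u] with ξ hξ
    rw [hξ]
  rw [h1, setIntegral_eq_integral_of_forall_compl_eq_zero h0,
    setIntegral_eq_integral_of_forall_compl_eq_zero (fun ξ hξ => h0 ξ fun h' => hξ (h h'))]

/-- Restriction `H¹(Ω) → H¹(ω)`. -/
def restrictH1 {ω Ω : Set Plane} (h : ω ⊆ Ω) : H1 Ω →L[ℝ] H1 ω :=
  (((PiLp.continuousLinearEquiv 2 ℝ (fun _ : Option (Fin 2) => L2 ω)).symm :
      (Option (Fin 2) → L2 ω) →L[ℝ] PiLp 2 (fun _ : Option (Fin 2) => L2 ω)).comp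
    (ContinuousLinearMap.pi fun j => (restrictL2 h).comp
      ((PiLp.proj 2 (fun _ : Option (Fin 2) => L2 Ω) j).comp (H1Submodule Ω).subtypeL))).codRestrict (H1Submodule ω)
    (by
      intro w i φ hφ
      change ∫ ξ in ω, pderiv i φ ξ * restrictL2 h (w.1 none) ξ =
        - ∫ ξ in ω, φ ξ * restrictL2 h (w.1 (some i)) ξ
      rw [integral_test_restrict h (hφ.pderiv i), integral_test_restrict h hφ]
      exact w.2 i φ (hφ.mono h))

/-- The regional gradient `χ_ω ∇ : H²(Ω) ∩ H¹₀(Ω) → (H¹(ω))²`. -/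
def regionalGrad {ω Ω : Set Plane} (h : ω ⊆ Ω) : State Ω →L[ℝ] H1Vec ω :=
  ((PiLp.continuousLinearEquiv 2 ℝ (fun _ : Fin 2 => H1 ω)).symm :
      (Fin 2 → H1 ω) →L[ℝ] H1Vec ω).comp
    (ContinuousLinearMap.pi fun i => (restrictH1 h).comp
      ((PiLp.proj 2 (fun _ : Fin 2 => H1 Ω) i).comp State.grad))

/-! ### The Dirichlet Laplacian on the state space -/

theorem eq_zero_of_test {Ω : Set Plane} (hΩ : IsOpen Ω) (v : L2 Ω)
    (h : ∀ φ, IsTest Ω φ → ∫ ξ in Ω, φ ξ * v ξ = 0) : v = 0 := by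
  rw [Lp.eq_zero_iff_ae_eq_zero]
  have hl : LocallyIntegrableOn (v : Plane → ℝ) Ω volume := by
    intro x hx
    obtain ⟨K, hK, hKx⟩ := exists_compact_mem_nhds x
    refine ⟨K ∩ Ω, inter_mem (mem_nhdsWithin_of_mem_nhds hKx) self_mem_nhdsWithin, ?_⟩
    have : IsFiniteMeasure ((volume.restrict Ω).restrict K) :=
      ⟨by
        rw [Measure.restrict_apply_univ]
        exact (Measure.restrict_apply_le Ω K).trans_lt hK.measure_lt_top⟩
    have h1 : Integrable (v : Plane → ℝ) ((volume.restrict Ω).restrict K) :=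
      ((Lp.memLp v).restrict K).integrable (by norm_num)
    rwa [Measure.restrict_restrict hK.measurableSet] at h1
  have := hΩ.ae_eq_zero_of_integral_contDiff_smul_eq_zero hl (fun g h1 h2 h3 => by
    rw [← h g ⟨h1, h2, h3⟩]
    simp only [smul_eq_mul]
    exact (setIntegral_eq_integral_of_forall_compl_eq_zero fun ξ hξ => by
      rw [image_eq_zero_of_notMem_tsupport (fun h' => hξ (h3 h')), zero_mul]).symm)
  rw [Filter.EventuallyEq, ae_restrict_iff' hΩ.measurableSet]
  exact this

theorem H1.val_injective {Ω : Set Plane} (hΩ : IsOpen Ω) :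
    Function.Injective (H1.val (Ω := Ω)).toLinearMap := by
  refine (injective_iff_map_eq_zero (H1.val (Ω := Ω)).toLinearMap).2 fun w hw => ?_
  have hw' : w.1 none = 0 := hw
  have hd : ∀ i, w.1 (some i) = 0 := fun i => eq_zero_of_test hΩ _ fun φ h => by
    have := w.2 i φ h
    rw [integral_test_mul (h.pderiv i), hw', inner_zero_right] at this
    linarith
  refine Subtype.ext (PiLp.ext fun j => ?_)
  cases j with
  | none => exact hw'
  | some i => exact hd i

/-- A state is determined by its underlying function. -/
theorem State.val_injective {Ω : Set Plane} (hΩ : IsOpen Ω) :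
    Function.Injective (State.val (Ω := Ω)).toLinearMap := by
  refine (injective_iff_map_eq_zero (State.val (Ω := Ω)).toLinearMap).2 fun w hw => ?_
  have h0 := (injective_iff_map_eq_zero (H1.val (Ω := Ω)).toLinearMap).1 (H1.val_injective hΩ)
  have h1 : w.1.fst = 0 := h0 _ hw
  have h2 : ∀ i, w.1.snd i = 0 := fun i => h0 _ ((w.2.2 i).trans (by rw [h1, map_zero]))
  exact Subtype.ext ((WithLp.equiv 2 _).injective (Prod.ext h1 (PiLp.ext h2)))

/-- The Dirichlet Laplacian `A = ∂²/∂ξ₁² + ∂²/∂ξ₂²` as an unbounded operator in the state space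
`X = H²(Ω) ∩ H¹₀(Ω)`, with domain `{x ∈ X : Δx ∈ X}`. -/
def dirichletLaplacian {Ω : Set Plane} (hΩ : IsOpen Ω) : State Ω →ₗ.[ℝ] State Ω where
  domain := (LinearMap.range (State.val (Ω := Ω)).toLinearMap).comap
    (State.lap (Ω := Ω)).toLinearMap
  toFun := (LinearEquiv.ofInjective (State.val (Ω := Ω)).toLinearMap
      (State.val_injective hΩ)).symm.toLinearMap.comp
    ((State.lap (Ω := Ω)).toLinearMap.restrict fun _ hx => hx)

theorem dirichletLaplacian_val {Ω : Set Plane} (hΩ : IsOpen Ω)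
    (x : (dirichletLaplacian hΩ).domain) :
    State.val (dirichletLaplacian hΩ x) = State.lap (x : State Ω) := by
  have := LinearEquiv.apply_symm_apply
    (LinearEquiv.ofInjective (State.val (Ω := Ω)).toLinearMap (State.val_injective hΩ))
    ⟨State.lap (x : State Ω), x.2⟩
  exact congrArg Subtype.val this

/-! ### Strongly continuous semigroups -/

/-- A strongly continuous one-parameter semigroup of bounded operators (only `t ≥ 0` matters). -/
structure C0Semigroup (X : Type*) [NormedAddCommGroup X] [NormedSpace ℝ X] where
  op : ℝ → X →L[ℝ] X
  op_zero : op 0 = ContinuousLinearMap.id ℝ X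
  op_add : ∀ s t, 0 ≤ s → 0 ≤ t → op (s + t) = (op s).comp (op t)
  strong : ∀ x, Tendsto (fun t => op t x) (𝓝[>] 0) (𝓝 x)

/-- `A` is the infinitesimal generator of the semigroup `S`. -/
def Generates {X : Type*} [NormedAddCommGroup X] [NormedSpace ℝ X]
    (A : X →ₗ.[ℝ] X) (S : C0Semigroup X) : Prop :=
  ∀ x y : X, (x, y) ∈ A.graph ↔
    Tendsto (fun t : ℝ => t⁻¹ • (S.op t x - x)) (𝓝[>] 0) (𝓝 y)

section Observers

variable {X U Y V : Type*} [NormedAddCommGroup X] [NormedSpace ℝ X]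
  [NormedAddCommGroup U] [NormedSpace ℝ U] [NormedAddCommGroup Y] [NormedSpace ℝ Y]
  [NormedAddCommGroup V] [NormedSpace ℝ V]

/-- Mild solution of `x' = A x + f`, `x(0) = x₀`, where `A` generates `S`. -/
def mildSolution (S : C0Semigroup X) (x₀ : X) (f : ℝ → X) (t : ℝ) : X :=
  S.op t x₀ + ∫ τ in (0 : ℝ)..t, S.op (t - τ) (f τ)

/-- Exponential stability of the semigroup `S` as seen through the (regional gradient)
operator `E`. -/
def ExpStable (E : X →L[ℝ] V) (S : C0Semigroup X) : Prop :=
  ∃ M α : ℝ, 0 < M ∧ 0 < α ∧ ∀ t, 0 ≤ t → ‖E.comp (S.op t)‖ ≤ M * Real.exp (-α * t)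

/-- `A` generates a strongly continuous semigroup which is stable through `E`. -/
def GeneratesExpStable (E : X →L[ℝ] V) (A : X →ₗ.[ℝ] X) : Prop :=
  ∃ S, Generates A S ∧ ExpStable E S

/-- Admissible controls: square integrable on every bounded time interval. -/
def IsControl (u : ℝ → U) : Prop :=
  ∀ t : ℝ, MemLp u 2 (volume.restrict (Ioc 0 t))

/-- The system `z' = F z + G u + H y` is an asymptotic regional gradient observer, with respect
to the operator `T`, of the system `x' = A x + B u`, `y = C x`. Here `E = χ_ω ∇` is the regional
gradient. The requirements are:
* `A` generates a strongly continuous semigroup, and `F` generates one which is stable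
  through `E`;
* `T` maps `D(A)` into `D(F)`;
* there are bounded `M`, `N` with `M C + N E T = E`, so that `M y + N E z` reconstructs the
  regional gradient of the state;
* `T A - F T = H C` on `D(A)` and `G = T B`;
* for all initial states `x₀`, `z₀` and all controls `u`, the regional gradients of
  `z(t)` and `T x(t)` become asymptotically equal. -/
def IsGradObserver (E : X →L[ℝ] V) (A : X →ₗ.[ℝ] X) (B : U →L[ℝ] X) (C : X →L[ℝ] Y)
    (T : X →L[ℝ] X) (F : X →ₗ.[ℝ] X) (G : U →L[ℝ] X) (H : Y →L[ℝ] X) : Prop :=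
  ∃ SA SF : C0Semigroup X, Generates A SA ∧ Generates F SF ∧ ExpStable E SF ∧
    (∃ (M : Y →L[ℝ] V) (N : V →L[ℝ] V), M.comp C + N.comp (E.comp T) = E) ∧
    (∀ x : A.domain, ∃ h : T x ∈ F.domain, T (A x) - F ⟨T x, h⟩ = H (C x)) ∧
    G = T.comp B ∧
    ∀ (x₀ z₀ : X) (u : ℝ → U), IsControl u →
      Tendsto (fun t =>
        let x := mildSolution SA x₀ fun τ => B (u τ)
        let z := mildSolution SF z₀ fun τ => G (u τ) + H (C (x τ))
        ‖E (z t) - E (T (x t))‖) atTop (𝓝 0)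

/-- The operator `A - H C` with domain `D(A)`. -/
def closedLoop (A : X →ₗ.[ℝ] X) (C : X →L[ℝ] Y) (H : Y →L[ℝ] X) : X →ₗ.[ℝ] X :=
  (-(H.comp C).toLinearMap) +ᵥ A

end Observers

/-! ### The diffusion system on a rectangle -/

/-- The open rectangle `]0, a₁[ × ]0, a₂[`. -/
def Rect (a₁ a₂ : ℝ) : Set Plane := {ξ | ξ 0 ∈ Ioo 0 a₁ ∧ ξ 1 ∈ Ioo 0 a₂}

theorem isOpen_Rect (a₁ a₂ : ℝ) : IsOpen (Rect a₁ a₂) := by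
  have hc : ∀ i : Fin 2, Continuous fun ξ : Plane => ξ i :=
    fun i => (PiLp.proj (𝕜 := ℝ) 2 (fun _ : Fin 2 => ℝ) i).continuous
  exact (isOpen_Ioo.preimage (hc 0)).inter (isOpen_Ioo.preimage (hc 1))

/-- `g` is the representative of the state `x` which is continuous on the closure of `Ω`. -/
def IsContinuousRep {Ω : Set Plane} (x : State Ω) (g : Plane → ℝ) : Prop :=
  ContinuousOn g (closure Ω) ∧ (State.val x : Plane → ℝ) =ᵐ[volume.restrict Ω] g

/-- `C` is the output operator `C x = x(b)` of a pointwise sensor at `b`. -/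
def IsPointSensor {Ω : Set Plane} (b : Plane) (C : State Ω →L[ℝ] ℝ) : Prop :=
  ∀ x, ∃ g, IsContinuousRep x g ∧ C x = g b

/-- `C` is the output operator `C x = ∫_σ x f` of a filament sensor supported on the curve `σ`
with density `f`, the integral being taken with respect to arc length (one-dimensional
Hausdorff measure). -/
def IsFilamentSensor {Ω : Set Plane} (σ : Set Plane) (f : Plane → ℝ)
    (C : State Ω →L[ℝ] ℝ) : Prop :=
  ∀ x, ∃ g, IsContinuousRep x g ∧ C x = ∫ ξ in σ, g ξ * f ξ ∂(Measure.hausdorffMeasure 1)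

/-- The set `σ` is symmetric about `b`: it is invariant under the reflection in the point `b`, or
under the reflection in one of the two axis-parallel lines through `b`. -/
def IsSymmetricAbout (b : Plane) (σ : Set Plane) : Prop :=
  (∀ ξ ∈ σ, !₂[2 * b 0 - ξ 0, 2 * b 1 - ξ 1] ∈ σ) ∨
  (∀ ξ ∈ σ, !₂[2 * b 0 - ξ 0, ξ 1] ∈ σ) ∨
  (∀ ξ ∈ σ, !₂[ξ 0, 2 * b 1 - ξ 1] ∈ σ)

/-- The diffusion system `x' = Δx + B u`, `y = C x` on the rectangle (homogeneous Dirichlet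
conditions) has observers `z' = Δz + B u - H (C z - y)`: some nonzero gain `H` makes `Δ - H C`
the generator of a semigroup whose gradient is stable on `ω`, and for every gain with this
property, and every bounded control operator `B`, the system in `z` is a regional gradient
observer on `ω`, with `T` the identity. -/
def ObserverExists {a₁ a₂ : ℝ} {ω : Set Plane} (hω : ω ⊆ Rect a₁ a₂)
    (C : State (Rect a₁ a₂) →L[ℝ] ℝ) : Prop :=
  let A := dirichletLaplacian (isOpen_Rect a₁ a₂)
  let E := regionalGrad hω
  (∃ H : ℝ →L[ℝ] State (Rect a₁ a₂), H ≠ 0 ∧ GeneratesExpStable E (closedLoop A C H)) ∧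
  ∀ H : ℝ →L[ℝ] State (Rect a₁ a₂), GeneratesExpStable E (closedLoop A C H) →
    ∀ (p : ℕ) (B : EuclideanSpace ℝ (Fin p) →L[ℝ] State (Rect a₁ a₂)),
      IsGradObserver E A B C (ContinuousLinearMap.id ℝ _) (closedLoop A C H) B H

end RegionalObserver

end

/-! Everything rests on the product sines `mode`, which diagonalize the Dirichlet Laplacian `A` on
the state space `X`, with eigenvalues `-eigval` bounded away from zero. Hence `A` is densely defined
and generates an explicit, exponentially decaying semigroup, and the argument works for every
bounded functional `C` on `X` (`observerExists`).

Convergence of the observer: with `F = A - HC`, the error `z - x` formally solves the homogeneous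
equation of `F`, so it equals `S_F(t)(z₀ - x₀)`, and the stability of `S_F` through the regional
gradient finishes. For mild solutions this needs `duhamel`, `S_A(t)x - S_F(t)x = ∫ S_F(t-s) HC
S_A(s)x ds`, and Fubini for the forcing term (`mildSolution_sub`).

A nonzero stabilizing gain (`exists_stabilizing_gain`): if `C` vanishes on all eigenvectors then `C
= 0` and any gain will do. Otherwise take `H` along an eigenvector `b j` with `C (b j) ≠ 0`, scaled
so that the `j`-th eigenvalue moves to `-ν`, where `ν` is half the spectral gap. Since `ν` differs
from all the `lam k`, a transvection conjugates `A - HC` to a diagonal operator, which again decays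
exponentially.

Diagonalization: the sines are complete in `L²` by Stone–Weierstrass (`eq_zero_of_inner_modeL2`).
Cutoffs place them in `H¹₀` (`smoothH1_prodFn_mem_H10`), Green's formula then gives the coefficients
of `Δx`, and `1 - Δ` transports completeness from `L²` to `X` (`hasSum_modeState`).

Boundedness of the sensors: in dimension two the squares of `stateScale` are summable, so
eigenfunction expansions of states converge uniformly. This gives a bounded map `contRep` from `X`
to bounded continuous functions, to be composed with evaluation or with integration against `f`. -/

noncomputable section

namespace RegionalObserver

/-! ### Strongly continuous semigroups: local bounds and joint continuity. -/

section Semigroups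

variable {X : Type*} [NormedAddCommGroup X] [NormedSpace ℝ X]

namespace C0Semigroup

theorem tendsto_Ici (S : C0Semigroup X) (x : X) :
    Tendsto (fun t => S.op t x) (𝓝[≥] 0) (𝓝 x) := by
  have h := S.strong x
  have h0 : S.op 0 x = x := by simp [S.op_zero]
  have h1 : ContinuousWithinAt (fun t => S.op t x) (Ioi 0) 0 := by
    rw [ContinuousWithinAt, h0]
    exact h
  have h2 := continuousWithinAt_Ioi_iff_Ici.1 h1
  rwa [ContinuousWithinAt, h0] at h2

theorem op_add_apply (S : C0Semigroup X) {s t : ℝ} (hs : 0 ≤ s) (ht : 0 ≤ t) (x : X) :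
    S.op (s + t) x = S.op s (S.op t x) := by
  rw [S.op_add s t hs ht]
  rfl

/-- Otherwise there are times `t n → 0` with `‖S.op (t n)‖ > n`. The orbits converge along them,
hence are bounded, which contradicts the uniform boundedness principle. -/
theorem exists_bound_near_zero [CompleteSpace X] (S : C0Semigroup X) :
    ∃ δ > 0, ∃ M : ℝ, ∀ t ∈ Icc 0 δ, ‖S.op t‖ ≤ M := by
  by_contra! h
  have h' : ∀ n : ℕ, ∃ t ∈ Icc (0 : ℝ) (1 / ((n : ℝ) + 1)), (n : ℝ) < ‖S.op t‖ :=
    fun n => h _ (by positivity) n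
  choose t ht hn using h'
  have ht0 : Tendsto t atTop (𝓝[≥] 0) := by
    refine tendsto_nhdsWithin_iff.2 ⟨?_, Eventually.of_forall fun n => (ht n).1⟩
    exact squeeze_zero (fun n => (ht n).1) (fun n => (ht n).2)
      tendsto_one_div_add_atTop_nhds_zero_nat
  obtain ⟨C, hC⟩ := banach_steinhaus (g := fun n => S.op (t n)) fun x => by
    obtain ⟨C, hC⟩ := (Metric.isBounded_range_of_tendsto _
      ((S.tendsto_Ici x).comp ht0)).exists_norm_le
    exact ⟨C, fun n => hC _ ⟨n, rfl⟩⟩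
  obtain ⟨n, hn'⟩ := exists_nat_gt C
  exact absurd (hC n) (by linarith [hn n])

/-- The semigroup law propagates the bound near zero in steps of length `δ`. -/
theorem exists_bound [CompleteSpace X] (S : C0Semigroup X) (T : ℝ) :
    ∃ M : ℝ, 0 ≤ M ∧ ∀ t, 0 ≤ t → t ≤ T → ‖S.op t‖ ≤ M := by
  obtain ⟨δ, hδ, M, hM⟩ := S.exists_bound_near_zero
  have hM0 : 0 ≤ M := (norm_nonneg _).trans (hM 0 ⟨le_rfl, hδ.le⟩)
  have key : ∀ n : ℕ, ∃ M' : ℝ, 0 ≤ M' ∧ ∀ t, 0 ≤ t → t ≤ n * δ → ‖S.op t‖ ≤ M' := by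
    intro n
    induction n with
    | zero => exact ⟨M, hM0, fun t h0 h1 => hM t ⟨h0, by simp at h1; linarith⟩⟩
    | succ n ih =>
      obtain ⟨M', hM'0, hM'⟩ := ih
      refine ⟨max M (M * M'), le_max_of_le_left hM0, fun t h0 h1 => ?_⟩
      rcases le_total t δ with h | h
      · exact (hM t ⟨h0, h⟩).trans (le_max_left _ _)
      · have : t = δ + (t - δ) := by ring
        rw [this, S.op_add _ _ hδ.le (by linarith)]
        refine (ContinuousLinearMap.opNorm_comp_le _ _).trans (le_trans ?_ (le_max_right _ _))
        refine mul_le_mul (hM δ ⟨hδ.le, le_rfl⟩) (hM' _ (by linarith) ?_) (norm_nonneg _) hM0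
        push_cast at h1
        linarith
  obtain ⟨n, hn⟩ := exists_nat_gt (T / δ)
  obtain ⟨M', h0, h⟩ := key n
  exact ⟨M', h0, fun t ht0 ht => h t ht0 (ht.trans ((div_lt_iff₀ hδ).1 hn).le)⟩

theorem norm_sub_le (S : C0Semigroup X) {T M : ℝ}
    (hM : ∀ t, 0 ≤ t → t ≤ T → ‖S.op t‖ ≤ M) (x : X) {s t : ℝ}
    (hs : 0 ≤ s) (hsT : s ≤ T) (ht : 0 ≤ t) (htT : t ≤ T) :
    ‖S.op t x - S.op s x‖ ≤ M * ‖S.op |t - s| x - x‖ := by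
  wlog hst : s ≤ t generalizing s t
  · rw [norm_sub_rev, abs_sub_comm]
    exact this ht htT hs hsT (le_of_not_ge hst)
  rw [abs_of_nonneg (sub_nonneg.2 hst)]
  have : S.op t x = S.op s (S.op (t - s) x) := by
    rw [← S.op_add_apply hs (sub_nonneg.2 hst)]
    congr 2
    ring
  rw [this, ← map_sub]
  exact (S.op s).le_of_opNorm_le (hM s hs hsT) _

variable [CompleteSpace X]

/-- The action of a strongly continuous semigroup is jointly continuous. -/
theorem continuous_op_max (S : C0Semigroup X) :
    Continuous fun p : ℝ × X => S.op (max p.1 0) p.2 := by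
  -- The truncation `max · 0` freezes the semigroup at the identity for negative times, so
  -- continuity can hold on all of `ℝ × X`. The estimate splits `S(t)w - S(s)v` into `S(t)(w - v)`
  -- and `S(t)v - S(s)v`.
  rw [continuous_iff_continuousAt]
  rintro ⟨r, v⟩
  obtain ⟨M, hM0, hM⟩ := S.exists_bound (|r| + 1)
  rw [ContinuousAt, tendsto_iff_norm_sub_tendsto_zero]
  have h1 : Tendsto (fun p : ℝ × X =>
      M * ‖p.2 - v‖ + M * ‖S.op |max p.1 0 - max r 0| v - v‖) (𝓝 (r, v)) (𝓝 (M * 0 + M * 0)) := by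
    refine (Tendsto.const_mul _ ?_).add (Tendsto.const_mul _ ?_)
    · exact tendsto_iff_norm_sub_tendsto_zero.1 (continuous_snd.tendsto (r, v))
    · refine tendsto_iff_norm_sub_tendsto_zero.1 ((S.tendsto_Ici v).comp ?_)
      refine tendsto_nhdsWithin_iff.2 ⟨?_, Eventually.of_forall fun p => mem_Ici.2 (abs_nonneg _)⟩
      have : Continuous fun p : ℝ × X => |max p.1 0 - max r 0| := by fun_prop
      simpa using this.tendsto (r, v)
  rw [mul_zero, add_zero] at h1
  have hev : ∀ᶠ p : ℝ × X in 𝓝 (r, v), max p.1 0 ≤ |r| + 1 := by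
    have : Continuous fun p : ℝ × X => max p.1 0 := by fun_prop
    refine (this.tendsto (r, v)).eventually_le_const ?_
    exact (max_le (le_abs_self r) (abs_nonneg r)).trans_lt (lt_add_one _)
  refine squeeze_zero' (Eventually.of_forall fun _ => norm_nonneg _) ?_ h1
  filter_upwards [hev] with p hp
  have hr : max r 0 ≤ |r| + 1 := (max_le (le_abs_self r) (abs_nonneg r)).trans (by linarith)
  calc ‖S.op (max p.1 0) p.2 - S.op (max r 0) v‖
      = ‖S.op (max p.1 0) (p.2 - v) + (S.op (max p.1 0) v - S.op (max r 0) v)‖ := by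
        rw [map_sub]; congr 1; abel
    _ ≤ _ := (norm_add_le _ _).trans (add_le_add
        ((S.op _).le_of_opNorm_le (hM _ (le_max_right _ _) hp) _)
        (S.norm_sub_le hM v (le_max_right _ _) hr (le_max_right _ _) hp))

theorem continuous_op_max_apply (S : C0Semigroup X) {Z : Type*} [TopologicalSpace Z]
    {r : Z → ℝ} {v : Z → X} (hr : Continuous r) (hv : Continuous v) :
    Continuous fun z => S.op (max (r z) 0) (v z) :=
  S.continuous_op_max.comp (hr.prodMk hv)

end C0Semigroup

/-! ### Generators, Duhamel's formula and mild solutions. -/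

theorem Generates.op_mem {A : X →ₗ.[ℝ] X} {S : C0Semigroup X} (h : Generates A S)
    {x y : X} (hxy : (x, y) ∈ A.graph) {s : ℝ} (hs : 0 ≤ s) :
    (S.op s x, S.op s y) ∈ A.graph := by
  rw [h] at hxy ⊢
  have h1 := ((S.op s).continuous.tendsto y).comp hxy
  refine h1.congr' ?_
  filter_upwards [self_mem_nhdsWithin] with t ht
  have ht' : (0 : ℝ) ≤ t := le_of_lt ht
  simp only [Function.comp_apply, map_smul, map_sub]
  rw [← S.op_add_apply hs ht', ← S.op_add_apply ht' hs, add_comm]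

theorem mildSolution_eq (S : C0Semigroup X) (x₀ : X) (f : ℝ → X) {t : ℝ} (ht : 0 ≤ t) :
    mildSolution S x₀ f t =
      S.op t x₀ + ∫ τ in Ioc 0 t, S.op (max (t - τ) 0) (f τ) := by
  rw [mildSolution, intervalIntegral.integral_of_le ht]
  congr 1
  refine setIntegral_congr_fun measurableSet_Ioc fun s hs => ?_
  simp only [max_eq_left (sub_nonneg.2 hs.2)]

theorem mem_graph_closedLoop {Y : Type*} [NormedAddCommGroup Y] [NormedSpace ℝ Y]
    (A : X →ₗ.[ℝ] X) (C : X →L[ℝ] Y) (H : Y →L[ℝ] X) (x y : X) :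
    (x, y) ∈ (closedLoop A C H).graph ↔ (x, y + H (C x)) ∈ A.graph := by
  simp only [LinearPMap.mem_graph_iff, closedLoop]
  constructor
  · rintro ⟨w, rfl, h⟩
    refine ⟨w, rfl, ?_⟩
    rw [LinearPMap.vadd_apply] at h
    simp at h
    rw [← h]
    abel
  · rintro ⟨w, rfl, h⟩
    refine ⟨w, rfl, ?_⟩
    rw [LinearPMap.vadd_apply]
    simp [h]

variable [CompleteSpace X]

/-- With `h = r - s` and `w = S_A(s)x`, the increment from `s` to `r` is `S_F(t-r)` applied to
`(S_A(h)w - w) - (S_F(h)w - w)`. After division by `h` the argument tends to `y - z`, and joint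
continuity of the action gives the limit. Generators being right limits, only a right derivative
comes out. -/
theorem hasDerivWithinAt_duhamel {A F : X →ₗ.[ℝ] X} {SA SF : C0Semigroup X}
    (hA : Generates A SA) (hF : Generates F SF) {x y z : X} {t s : ℝ} (hs : 0 ≤ s) (hst : s < t)
    (hy : (SA.op s x, y) ∈ A.graph) (hz : (SA.op s x, z) ∈ F.graph) :
    HasDerivWithinAt (fun s => SF.op (t - s) (SA.op s x)) (SF.op (t - s) (y - z)) (Ioi s) s := by
  rw [hasDerivWithinAt_iff_tendsto_slope' self_notMem_Ioi]
  rw [hA] at hy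
  rw [hF] at hz
  have hsub : Tendsto (fun r : ℝ => r - s) (𝓝[>] s) (𝓝[>] 0) := by
    refine tendsto_nhdsWithin_iff.2 ⟨?_, ?_⟩
    · have : Continuous fun r : ℝ => r - s := by fun_prop
      simpa using (this.tendsto s).mono_left nhdsWithin_le_nhds
    · filter_upwards [self_mem_nhdsWithin] with r hr
      exact mem_Ioi.2 (sub_pos.2 (mem_Ioi.1 hr))
  have h1 := (hy.sub hz).comp hsub
  have h2 : Tendsto (fun r : ℝ => t - r) (𝓝[>] s) (𝓝 (t - s)) := by
    have : Continuous fun r : ℝ => t - r := by fun_prop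
    exact (this.tendsto s).mono_left nhdsWithin_le_nhds
  have h3 := (SF.continuous_op_max.tendsto (t - s, y - z)).comp (h2.prodMk_nhds h1)
  simp only [max_eq_left (sub_nonneg.2 hst.le)] at h3
  refine h3.congr' ?_
  filter_upwards [Ioo_mem_nhdsGT hst] with r hr
  have hr0 : 0 ≤ r - s := sub_nonneg.2 hr.1.le
  simp only [Function.comp_apply, max_eq_left (sub_nonneg.2 hr.2.le)]
  rw [slope_def_module, ← smul_sub, map_smul, sub_sub_sub_cancel_right, map_sub]
  congr 2
  · rw [← SA.op_add_apply hr0 hs, sub_add_cancel]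
  · rw [← SF.op_add_apply (sub_nonneg.2 hr.2.le) hr0]
    congr 2
    ring

/-- Duhamel's formula for a bounded perturbation of a generator. -/
theorem duhamel {A F : X →ₗ.[ℝ] X} {SA SF : C0Semigroup X}
    (hA : Generates A SA) (hF : Generates F SF) (hdense : Dense (A.domain : Set X)) (P : X →L[ℝ] X)
    (hP : ∀ x y, (x, y) ∈ A.graph → (x, y - P x) ∈ F.graph) (x : X) {t : ℝ} (ht : 0 ≤ t) :
    ∫ s in (0 : ℝ)..t, SF.op (t - s) (P (SA.op s x)) = SA.op t x - SF.op t x := by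
  have hcong : ∀ x : X, ∫ s in (0 : ℝ)..t, SF.op (t - s) (P (SA.op s x)) =
      ∫ s in (0 : ℝ)..t, SF.op (max (t - s) 0) (P (SA.op (max s 0) x)) := fun x => by
    refine intervalIntegral.integral_congr fun s hs => ?_
    rw [uIcc_of_le ht] at hs
    simp only [max_eq_left hs.1, max_eq_left (sub_nonneg.2 hs.2)]
  have hcont : Continuous fun p : X × ℝ =>
      SF.op (max (t - p.2) 0) (P (SA.op (max p.2 0) p.1)) :=
    SF.continuous_op_max_apply (by fun_prop)
      (P.continuous.comp (SA.continuous_op_max_apply continuous_snd continuous_fst))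
  have hcx : ∀ x : X, Continuous fun s : ℝ =>
      SF.op (max (t - s) 0) (P (SA.op (max s 0) x)) := fun x =>
    hcont.comp (continuous_const.prodMk continuous_id)
  rw [hcong]
  -- Both sides are continuous in `x`, so the identity need only be proved on the dense domain,
  -- where the integrand is a derivative.
  refine hdense.induction (P := fun x =>
    ∫ s in (0 : ℝ)..t, SF.op (max (t - s) 0) (P (SA.op (max s 0) x)) = SA.op t x - SF.op t x)
    ?_ ?_ x
  · intro x hx
    rw [← hcong]
    have hg : (x, A ⟨x, hx⟩) ∈ A.graph := A.mem_graph ⟨x, hx⟩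
    -- For a continuous function, a right derivative in the interior suffices for the fundamental
    -- theorem of calculus.
    have h := intervalIntegral.integral_eq_sub_of_hasDeriv_right_of_le (a := 0) (b := t)
      (f := fun s => SF.op (t - s) (SA.op s x))
      (f' := fun s => SF.op (t - s) (P (SA.op s x))) ht ?_ ?_ ?_
    · rw [h]
      simp [SA.op_zero, SF.op_zero]
    · refine ContinuousOn.congr (f := fun s => SF.op (max (t - s) 0) (SA.op (max s 0) x)) ?_ ?_
      · exact (SF.continuous_op_max_apply (by fun_prop)
          (SA.continuous_op_max_apply continuous_id continuous_const)).continuousOn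
      · intro s hs
        simp only [max_eq_left hs.1, max_eq_left (sub_nonneg.2 hs.2)]
    · intro s hs
      have h1 := hA.op_mem hg hs.1.le
      have h2 := hasDerivWithinAt_duhamel hA hF hs.1.le hs.2 h1 (hP _ _ h1)
      rwa [sub_sub_cancel] at h2
    · have := (hcx x).intervalIntegrable (μ := volume) 0 t
      refine this.congr_uIoo fun s hs => ?_
      rw [uIoo_of_le ht] at hs
      simp only [max_eq_left hs.1.le, max_eq_left (sub_nonneg.2 hs.2.le)]
  · refine isClosed_eq ?_ (by fun_prop)
    exact intervalIntegral.continuous_parametric_intervalIntegral_of_continuous' (hcont) 0 t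

theorem C0Semigroup.integrable_op (S : C0Semigroup X) {t : ℝ} {f : ℝ → X}
    (hf : IntegrableOn f (Ioc 0 t)) : IntegrableOn (fun s => S.op (max (t - s) 0) (f s)) (Ioc 0 t) := by
  obtain ⟨M, hM0, hM⟩ := S.exists_bound t
  refine (hf.norm.const_mul M).mono' ?_ ?_
  · exact S.continuous_op_max.comp_aestronglyMeasurable
      (AEStronglyMeasurable.prodMk (by fun_prop) hf.aestronglyMeasurable)
  · refine (ae_restrict_mem measurableSet_Ioc).mono fun s hs => ?_
    exact (S.op _).le_of_opNorm_le
      (hM _ (le_max_right _ _) (max_le (by linarith [hs.1]) (hs.1.le.trans hs.2))) _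

/-- Justifies Fubini on the triangle `s ≤ τ`, encoded by the indicator: the semigroups are bounded
on `[0, t]`, so the kernel is dominated by a constant times `‖f s‖`. -/
theorem integrable_duhamel_kernel (SA SF : C0Semigroup X) (P : X →L[ℝ] X) {t : ℝ} {f : ℝ → X}
    (hf : IntegrableOn f (Ioc 0 t)) :
    Integrable (fun p : ℝ × ℝ => indicator {p : ℝ × ℝ | p.2 ≤ p.1}
      (fun p => SF.op (max (t - p.1) 0) (P (SA.op (max (p.1 - p.2) 0) (f p.2)))) p)
      ((volume.restrict (Ioc 0 t)).prod (volume.restrict (Ioc 0 t))) := by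
  obtain ⟨M, hM0, hM⟩ := SA.exists_bound t
  obtain ⟨M', hM'0, hM'⟩ := SF.exists_bound t
  have hms : MeasurableSet {p : ℝ × ℝ | p.2 ≤ p.1} :=
    measurableSet_le measurable_snd measurable_fst
  refine ((hf.norm.comp_snd (volume.restrict (Ioc 0 t))).const_mul (M' * (‖P‖ * M))).mono' ?_ ?_
  · refine AEStronglyMeasurable.indicator ?_ hms
    have h1 : AEStronglyMeasurable (fun p : ℝ × ℝ => SA.op (max (p.1 - p.2) 0) (f p.2))
        ((volume.restrict (Ioc 0 t)).prod (volume.restrict (Ioc 0 t))) :=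
      SA.continuous_op_max.comp_aestronglyMeasurable
        (AEStronglyMeasurable.prodMk (by fun_prop) hf.aestronglyMeasurable.comp_snd)
    exact SF.continuous_op_max.comp_aestronglyMeasurable
      (AEStronglyMeasurable.prodMk (by fun_prop) (P.continuous.comp_aestronglyMeasurable h1))
  · rw [Measure.prod_restrict]
    refine (ae_restrict_mem (measurableSet_Ioc.prod measurableSet_Ioc)).mono fun p hp => ?_
    obtain ⟨h1, h2⟩ := hp
    refine (norm_indicator_le_norm_self _ _).trans ?_
    have ht : 0 ≤ t := h1.1.le.trans h1.2
    refine ((SF.op _).le_of_opNorm_le (hM' _ (le_max_right _ _)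
      (max_le (by linarith [h1.1]) ht)) _).trans ?_
    rw [mul_assoc, mul_assoc]
    refine mul_le_mul_of_nonneg_left ?_ hM'0
    refine (P.le_opNorm _).trans (mul_le_mul_of_nonneg_left ?_ (norm_nonneg _))
    exact (SA.op _).le_of_opNorm_le (hM _ (le_max_right _ _)
      (max_le (by linarith [h1.2, h2.1]) ht)) _

/-- The mild solutions of `x' = A x + f` and of `z' = (A - P) z + f + P x` differ by an orbit of
the semigroup generated by `A - P`. -/
theorem mildSolution_sub {A F : X →ₗ.[ℝ] X} {SA SF : C0Semigroup X}
    (hA : Generates A SA) (hF : Generates F SF) (hdense : Dense (A.domain : Set X)) (P : X →L[ℝ] X)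
    (hP : ∀ x y, (x, y) ∈ A.graph → (x, y - P x) ∈ F.graph) (x₀ z₀ : X) {t : ℝ} (ht : 0 ≤ t)
    {f : ℝ → X} (hf : IntegrableOn f (Ioc 0 t)) :
    mildSolution SF z₀ (fun τ => f τ + P (mildSolution SA x₀ f τ)) t - mildSolution SA x₀ f t =
      SF.op t (z₀ - x₀) := by
  have hk := integrable_duhamel_kernel SA SF P hf
  set μ := volume.restrict (Ioc 0 t)
  set G : ℝ × ℝ → X := fun p => indicator {p : ℝ × ℝ | p.2 ≤ p.1}
      (fun p => SF.op (max (t - p.1) 0) (P (SA.op (max (p.1 - p.2) 0) (f p.2)))) p with hG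
  -- Integrating first in `s` produces `S_F(t-τ)P` applied to the forced part of the state at time
  -- `τ`.
  have hinner : ∀ τ ∈ Ioc 0 t, ∫ s, G (τ, s) ∂μ =
      SF.op (max (t - τ) 0) (P (∫ s in Ioc 0 τ, SA.op (max (τ - s) 0) (f s))) := by
    intro τ hτ
    have h1 : (fun s => G (τ, s)) = indicator (Iic τ)
        (fun s => SF.op (max (t - τ) 0) (P (SA.op (max (τ - s) 0) (f s)))) := by
      funext s
      simp only [hG, indicator, mem_ofPred_eq, mem_Iic]
    rw [h1, integral_indicator measurableSet_Iic, Measure.restrict_restrict measurableSet_Iic]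
    have h2 : Iic τ ∩ Ioc 0 t = Ioc 0 τ := by
      ext s
      simp only [mem_inter_iff, mem_Iic, mem_Ioc]
      constructor
      · rintro ⟨h, h', -⟩; exact ⟨h', h⟩
      · rintro ⟨h, h'⟩; exact ⟨h', h, h'.trans hτ.2⟩
    rw [h2]
    exact ((SF.op (max (t - τ) 0)).comp P).integral_comp_comm
      (SA.integrable_op (hf.mono_set (Ioc_subset_Ioc_right hτ.2)))
  -- Integrating first in `τ` leaves Duhamel's formula for the orbit of `f s` started at time `s`.
  have houter : ∀ s ∈ Ioc 0 t, ∫ τ, G (τ, s) ∂μ =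
      SA.op (max (t - s) 0) (f s) - SF.op (max (t - s) 0) (f s) := by
    intro s hs
    have h1 : (fun τ => G (τ, s)) = indicator (Ici s)
        (fun τ => SF.op (max (t - τ) 0) (P (SA.op (max (τ - s) 0) (f s)))) := by
      funext τ
      simp only [hG, indicator, mem_ofPred_eq, mem_Ici]
    rw [h1, integral_indicator measurableSet_Ici, Measure.restrict_restrict measurableSet_Ici]
    have h2 : Ici s ∩ Ioc 0 t = Icc s t := by
      ext τ
      simp only [mem_inter_iff, mem_Ici, mem_Ioc, mem_Icc]
      constructor
      · rintro ⟨h, -, h'⟩; exact ⟨h, h'⟩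
      · rintro ⟨h, h'⟩; exact ⟨h, hs.1.trans_le h, h'⟩
    rw [h2, integral_Icc_eq_integral_Ioc, max_eq_left (sub_nonneg.2 hs.2),
      ← duhamel hA hF hdense P hP (f s) (sub_nonneg.2 hs.2), ← intervalIntegral.integral_of_le hs.2]
    have h3 := intervalIntegral.integral_comp_sub_right (a := s) (b := t)
      (fun r => SF.op (t - s - r) (P (SA.op r (f s)))) s
    rw [sub_self] at h3
    rw [← h3]
    refine intervalIntegral.integral_congr fun τ hτ => ?_
    rw [uIcc_of_le hs.2] at hτ
    simp only [max_eq_left (sub_nonneg.2 hτ.1), max_eq_left (sub_nonneg.2 hτ.2)]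
    congr 2
    ring
  have hfree : Continuous fun τ : ℝ => SF.op (max (t - τ) 0) (P (SA.op (max τ 0) x₀)) :=
    SF.continuous_op_max_apply (by fun_prop)
      (P.continuous.comp (SA.continuous_op_max_apply continuous_id continuous_const))
  have hsplit : ∫ τ, SF.op (max (t - τ) 0) (f τ + P (mildSolution SA x₀ f τ)) ∂μ =
      ∫ τ, SF.op (max (t - τ) 0) (f τ) ∂μ + (SA.op t x₀ - SF.op t x₀) +
        ∫ τ, ∫ s, G (τ, s) ∂μ ∂μ := by
    have hi2 : Integrable (fun τ => SF.op (max (t - τ) 0) (P (SA.op (max τ 0) x₀))) μ :=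
      hfree.integrableOn_Ioc
    have hd : SA.op t x₀ - SF.op t x₀ =
        ∫ τ, SF.op (max (t - τ) 0) (P (SA.op (max τ 0) x₀)) ∂μ := by
      rw [← duhamel hA hF hdense P hP x₀ ht, intervalIntegral.integral_of_le ht]
      refine setIntegral_congr_fun measurableSet_Ioc fun s hs => ?_
      simp only [max_eq_left (sub_nonneg.2 hs.2), max_eq_left hs.1.le]
    have e1 := integral_add (SF.integrable_op hf) hi2
    have e2 := integral_add (f := fun τ => SF.op (max (t - τ) 0) (f τ) +
      SF.op (max (t - τ) 0) (P (SA.op (max τ 0) x₀))) ((SF.integrable_op hf).add hi2)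
      hk.integral_prod_left
    rw [hd, ← e1, ← e2]
    refine setIntegral_congr_fun measurableSet_Ioc fun τ hτ => ?_
    simp only [hinner τ hτ, mildSolution_eq SA x₀ f hτ.1.le, map_add, max_eq_left hτ.1.le,
      add_assoc]
  -- After the swap, the terms containing `f` cancel and so do those containing `S_A(t)x₀`.
  rw [mildSolution_eq SF _ _ ht, mildSolution_eq SA _ _ ht, hsplit, integral_integral_swap hk,
    setIntegral_congr_fun measurableSet_Ioc houter,
    integral_sub (SA.integrable_op hf) (SF.integrable_op hf), map_sub]
  abel

theorem IsControl.integrableOn {U : Type*} [NormedAddCommGroup U] {u : ℝ → U} (hu : IsControl u)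
    (t : ℝ) : IntegrableOn u (Ioc 0 t) :=
  (hu t).integrable (by norm_num)

/-- If `A` is a densely defined generator and `A - H C` generates a semigroup which is stable
through `E`, then `z' = (A - H C) z + B u + H y` is an observer. -/
theorem isGradObserver_closedLoop {U Y V : Type*} [NormedAddCommGroup U] [NormedSpace ℝ U]
    [NormedAddCommGroup Y] [NormedSpace ℝ Y] [NormedAddCommGroup V] [NormedSpace ℝ V]
    (E : X →L[ℝ] V) {A : X →ₗ.[ℝ] X} {SA : C0Semigroup X} (hA : Generates A SA)
    (hdense : Dense (A.domain : Set X)) (B : U →L[ℝ] X) (C : X →L[ℝ] Y) (H : Y →L[ℝ] X)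
    (hF : GeneratesExpStable E (closedLoop A C H)) :
    IsGradObserver E A B C (ContinuousLinearMap.id ℝ X) (closedLoop A C H) B H := by
  obtain ⟨SF, hSF, M, α, hM, hα, hs⟩ := hF
  -- Since `T` is the identity, `M = 0` and `N = 1` reconstruct the gradient from `z` alone.
  refine ⟨SA, SF, hA, hSF, ⟨M, α, hM, hα, hs⟩, ⟨0, ContinuousLinearMap.id ℝ V, by simp⟩,
    fun x => ⟨x.2, ?_⟩, by simp, fun x₀ z₀ u hu => ?_⟩
  · simp only [ContinuousLinearMap.id_apply]
    have : closedLoop A C H ⟨x, x.2⟩ = -(H.comp C).toLinearMap x + A x := rfl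
    rw [this]
    simp
  · have hP : ∀ x y, (x, y) ∈ A.graph → (x, y - (H.comp C) x) ∈ (closedLoop A C H).graph := by
      intro x y hxy
      rw [mem_graph_closedLoop]
      simpa using hxy
    have hbound : Tendsto (fun t => M * Real.exp (-α * t) * ‖z₀ - x₀‖) atTop (𝓝 (M * 0 * ‖z₀ - x₀‖)) := by
      refine (Tendsto.const_mul M ?_).mul_const _
      refine Real.tendsto_exp_atBot.comp ?_
      exact tendsto_id.const_mul_atTop_of_neg (neg_lt_zero.2 hα)
    rw [mul_zero, zero_mul] at hbound
    refine squeeze_zero' (Eventually.of_forall fun _ => norm_nonneg _) ?_ hbound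
    filter_upwards [eventually_ge_atTop 0] with t ht
    have h := mildSolution_sub hA hSF hdense (H.comp C) hP x₀ z₀ ht
      (f := fun τ => B (u τ)) (B.integrable_comp (hu.integrableOn t))
    simp only [ContinuousLinearMap.id_apply]
    rw [← map_sub]
    simp only [ContinuousLinearMap.comp_apply] at h
    rw [h]
    exact (E.comp (SF.op t)).le_of_opNorm_le (hs t ht) _

end Semigroups

/-! ### Semigroups that are diagonal in a Hilbert basis. -/

section Diagonal

variable {ι X : Type*} [NormedAddCommGroup X] [InnerProductSpace ℝ X]

theorem hilbertBasis_ext (b : HilbertBasis ι ℝ X) {x y : X} (h : ∀ k, b.repr x k = b.repr y k) :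
    x = y :=
  b.repr.injective (lp.ext (funext h))

theorem hasSum_sq_repr (b : HilbertBasis ι ℝ X) (x : X) :
    HasSum (fun k => b.repr x k ^ 2) (‖x‖ ^ 2) := by
  have h := lp.hasSum_norm (p := 2) (by norm_num) (b.repr x)
  rw [b.repr.norm_map] at h
  simpa using h

/-- The bounded operator which is diagonal in the basis `b`, with eigenvalues `m`. -/
def diagOp (b : HilbertBasis ι ℝ X) (m : ι → ℝ) {K : ℝ} (hK : 0 ≤ K) (hm : ∀ k, |m k| ≤ K) :
    X →L[ℝ] X :=
  b.repr.symm.toContinuousLinearEquiv.toContinuousLinearMap.comp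
    ((lp.mapCLM 2 (fun k => m k • ContinuousLinearMap.id ℝ ℝ) hK (fun k => by
      rw [norm_smul]
      refine (mul_le_mul_of_nonneg_left ContinuousLinearMap.norm_id_le (norm_nonneg _)).trans ?_
      simpa using hm k)).comp
      b.repr.toContinuousLinearEquiv.toContinuousLinearMap)

theorem repr_diagOp (b : HilbertBasis ι ℝ X) (m : ι → ℝ) {K : ℝ} (hK : 0 ≤ K)
    (hm : ∀ k, |m k| ≤ K) (x : X) (k : ι) :
    b.repr (diagOp b m hK hm x) k = m k * b.repr x k := by
  simp [diagOp]

theorem norm_diagOp_le (b : HilbertBasis ι ℝ X) (m : ι → ℝ) {K : ℝ} (hK : 0 ≤ K)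
    (hm : ∀ k, |m k| ≤ K) : ‖diagOp b m hK hm‖ ≤ K := by
  refine ContinuousLinearMap.opNorm_le_bound _ hK fun x => ?_
  have : ‖diagOp b m hK hm x‖ ^ 2 ≤ (K * ‖x‖) ^ 2 := by
    rw [mul_pow]
    refine hasSum_le (fun k => ?_) (hasSum_sq_repr b _) ((hasSum_sq_repr b x).mul_left _)
    rw [repr_diagOp, mul_pow]
    refine mul_le_mul_of_nonneg_right ?_ (sq_nonneg _)
    rw [← sq_abs]
    exact pow_le_pow_left₀ (abs_nonneg _) (hm k) 2
  exact (abs_le_of_sq_le_sq' this (by positivity)).2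

/-- Convergence to `0` of vectors with coordinates `m t k * x k`, when the multipliers are bounded
and converge to `0`. -/
theorem tendsto_zero_of_repr (b : HilbertBasis ι ℝ X) {T : Type*} {l : Filter T}
    {m : T → ι → ℝ} {K : ℝ} (hK : ∀ᶠ t in l, ∀ k, |m t k| ≤ K)
    (hm : ∀ k, Tendsto (fun t => m t k) l (𝓝 0)) (x : X) {v : T → X}
    (hv : ∀ᶠ t in l, ∀ k, b.repr (v t) k = m t k * b.repr x k) : Tendsto v l (𝓝 0) := by
  rw [tendsto_zero_iff_norm_tendsto_zero]
  have h1 : Tendsto (fun t => ∑' k, (b.repr (v t) k) ^ 2) l (𝓝 (∑' _ : ι, (0 : ℝ))) := by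
    -- Dominated convergence in the Parseval series, with the square-summable majorant `K² x_k²`.
    refine tendsto_tsum_of_dominated_convergence
      (bound := fun k => K ^ 2 * (b.repr x k) ^ 2) ((hasSum_sq_repr b x).summable.mul_left _) ?_ ?_
    · intro k
      have h2 : Tendsto (fun t => (m t k * b.repr x k) ^ 2) l (𝓝 ((0 * b.repr x k) ^ 2)) :=
        ((hm k).mul_const _).pow 2
      rw [zero_mul, zero_pow two_ne_zero] at h2
      refine h2.congr' ?_
      filter_upwards [hv] with t ht
      rw [ht]
    · filter_upwards [hv, hK] with t ht htK k
      rw [ht, norm_pow, norm_mul, mul_pow, Real.norm_eq_abs, Real.norm_eq_abs, sq_abs (b.repr x k)]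
      exact mul_le_mul_of_nonneg_right (pow_le_pow_left₀ (abs_nonneg _) (htK k) 2) (sq_nonneg _)
  rw [tsum_zero] at h1
  have h3 : Tendsto (fun t => √(‖v t‖ ^ 2)) l (𝓝 √0) := by
    refine (Real.continuous_sqrt.tendsto 0).comp (h1.congr fun t => ?_)
    exact (hasSum_sq_repr b (v t)).tsum_eq
  simpa using h3

variable (b : HilbertBasis ι ℝ X) {lam : ι → ℝ} (hlam : ∀ k, 0 < lam k)

include hlam in
theorem abs_exp_neg_mul_max_le (t : ℝ) (k : ι) : |Real.exp (-lam k * max t 0)| ≤ 1 := by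
  rw [abs_of_pos (Real.exp_pos _), Real.exp_le_one_iff]
  exact mul_nonpos_of_nonpos_of_nonneg (by linarith [hlam k]) (le_max_right _ _)

theorem tendsto_exp_neg_mul_slope {c : ℝ} (hc : 0 < c) :
    Tendsto (fun t : ℝ => (Real.exp (-c * t) - 1) / (-c * t)) (𝓝[>] 0) (𝓝 1) := by
  have h := (Real.hasDerivAt_exp 0)
  rw [hasDerivAt_iff_tendsto_slope, Real.exp_zero] at h
  have h1 : Tendsto (fun t : ℝ => -c * t) (𝓝[>] 0) (𝓝[≠] 0) := by
    refine tendsto_nhdsWithin_iff.2 ⟨?_, ?_⟩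
    · have : Continuous fun t : ℝ => -c * t := by fun_prop
      simpa using (this.tendsto 0).mono_left nhdsWithin_le_nhds
    · filter_upwards [self_mem_nhdsWithin] with t ht
      have : (0 : ℝ) < t := ht
      exact mem_compl_singleton_iff.2 (by nlinarith [mul_pos hc this])
  refine (h.comp h1).congr fun t => ?_
  simp [slope_def_field]

/-- The inequality `1 - s ≤ exp (-s) ≤ 1` puts the quotient in `[0, 1]`. The bound is uniform over
the unbounded eigenvalues, which is what dominated convergence in `diagSemigroup_generator`
requires. -/
theorem abs_exp_slope_sub_one_le {s : ℝ} (hs : 0 < s) :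
    |(Real.exp (-s) - 1) / (-s) - 1| ≤ 1 := by
  have h1 : 0 ≤ (1 - Real.exp (-s)) / s :=
    div_nonneg (by linarith [Real.exp_le_one_iff.2 (by linarith : -s ≤ 0)]) hs.le
  have h2 : (1 - Real.exp (-s)) / s ≤ 1 := by
    rw [div_le_one hs]
    linarith [Real.add_one_le_exp (-s)]
  have h3 : (Real.exp (-s) - 1) / (-s) = (1 - Real.exp (-s)) / s := by
    rw [div_neg, ← neg_div]
    congr 1
    ring
  rw [h3, abs_le]
  constructor <;> linarith

/-- The semigroup with eigenvalues `exp (-λ t)` in the basis `b`. -/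
def diagSemigroup : C0Semigroup X where
  op t := diagOp b (fun k => Real.exp (-lam k * max t 0)) zero_le_one
    (abs_exp_neg_mul_max_le hlam t)
  op_zero := by
    ext x
    refine hilbertBasis_ext b fun k => ?_
    simp [repr_diagOp]
  op_add s t hs ht := by
    ext x
    refine hilbertBasis_ext b fun k => ?_
    rw [ContinuousLinearMap.comp_apply, repr_diagOp, repr_diagOp, repr_diagOp, ← mul_assoc,
      ← Real.exp_add, max_eq_left hs, max_eq_left ht, max_eq_left (add_nonneg hs ht)]
    ring_nf
  strong x := by
    rw [← tendsto_sub_nhds_zero_iff]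
    refine tendsto_zero_of_repr b (m := fun t k => Real.exp (-lam k * max t 0) - 1) (K := 2)
      (Eventually.of_forall fun t k => ?_) (fun k => ?_) x (Eventually.of_forall fun t k => ?_)
    · refine (abs_sub _ _).trans ?_
      have := abs_exp_neg_mul_max_le hlam t k
      rw [abs_one]
      linarith
    · have : Continuous fun t : ℝ => Real.exp (-lam k * max t 0) - 1 := by fun_prop
      simpa using (this.tendsto 0).mono_left nhdsWithin_le_nhds
    · rw [map_sub, lp.coeFn_sub, Pi.sub_apply, repr_diagOp]
      ring

theorem repr_diagSemigroup (t : ℝ) (x : X) (k : ι) :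
    b.repr ((diagSemigroup b hlam).op t x) k = Real.exp (-lam k * max t 0) * b.repr x k :=
  repr_diagOp b _ zero_le_one (abs_exp_neg_mul_max_le hlam t) x k

theorem norm_diagSemigroup_le {c : ℝ} (hc : ∀ k, c ≤ lam k) {t : ℝ} (ht : 0 ≤ t) :
    ‖(diagSemigroup b hlam).op t‖ ≤ Real.exp (-c * t) := by
  have hb : ∀ k, |Real.exp (-lam k * max t 0)| ≤ Real.exp (-c * t) := fun k => by
    rw [abs_of_pos (Real.exp_pos _), max_eq_left ht, Real.exp_le_exp]
    nlinarith [hc k]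
  have : (diagSemigroup b hlam).op t = diagOp b _ (Real.exp_pos _).le hb := by
    ext x
    exact hilbertBasis_ext b fun k => by rw [repr_diagSemigroup, repr_diagOp]
  rw [this]
  exact norm_diagOp_le b _ _ _

/-- The `k`-th coordinate of the difference quotient is `-λ_k x_k` times a factor that tends to `1`.
If these numbers are the coordinates of a vector `y`, the factors are bounded and the quotient
converges to `y` in norm. Conversely, coordinates are continuous, so a limit must have these
coordinates. Thus the generator has the maximal domain. -/
theorem diagSemigroup_generator (x y : X) :
    (∀ k, b.repr y k = -lam k * b.repr x k) ↔
      Tendsto (fun t : ℝ => t⁻¹ • ((diagSemigroup b hlam).op t x - x)) (𝓝[>] 0) (𝓝 y) := by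
  have hrepr : ∀ t : ℝ, 0 < t → ∀ k,
      b.repr (t⁻¹ • ((diagSemigroup b hlam).op t x - x)) k =
        (Real.exp (-lam k * t) - 1) / (-lam k * t) * (-lam k * b.repr x k) := by
    intro t ht k
    have h1 := (hlam k).ne'
    rw [map_smul, map_sub, lp.coeFn_smul, lp.coeFn_sub, Pi.smul_apply, Pi.sub_apply,
      repr_diagSemigroup, max_eq_left ht.le, smul_eq_mul]
    field_simp
  constructor
  · intro h
    rw [← tendsto_sub_nhds_zero_iff]
    refine tendsto_zero_of_repr b
      (m := fun t k => (Real.exp (-lam k * t) - 1) / (-lam k * t) - 1) (K := 1) ?_ (fun k => ?_) y ?_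
    · filter_upwards [self_mem_nhdsWithin] with t ht k
      rw [neg_mul]
      exact abs_exp_slope_sub_one_le (mul_pos (hlam k) ht)
    · simpa using (tendsto_exp_neg_mul_slope (hlam k)).sub_const 1
    · filter_upwards [self_mem_nhdsWithin] with t ht k
      rw [map_sub, lp.coeFn_sub, Pi.sub_apply, hrepr t ht, h]
      ring
  · intro h k
    have hc : Continuous fun v : X => b.repr v k := by
      simp_rw [b.repr_apply_apply]
      fun_prop
    have h1 := (hc.tendsto y).comp h
    have h2 := (tendsto_exp_neg_mul_slope (hlam k)).mul_const (-lam k * b.repr x k)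
    rw [one_mul] at h2
    refine tendsto_nhds_unique h1 (h2.congr' ?_)
    filter_upwards [self_mem_nhdsWithin] with t ht
    exact (hrepr t ht k).symm

theorem generates_diagSemigroup {A : X →ₗ.[ℝ] X}
    (hA : ∀ x y, (x, y) ∈ A.graph ↔ ∀ k, b.repr y k = -lam k * b.repr x k) :
    Generates A (diagSemigroup b hlam) :=
  fun x y => (hA x y).trans (diagSemigroup_generator b hlam x y)

theorem dense_domain_of_diagonal {A : X →ₗ.[ℝ] X}
    (hA : ∀ x y, (x, y) ∈ A.graph ↔ ∀ k, b.repr y k = -lam k * b.repr x k) :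
    Dense (A.domain : Set X) := by
  classical
  have h1 : Submodule.span ℝ (Set.range b) ≤ A.domain := by
    rw [Submodule.span_le]
    rintro _ ⟨j, rfl⟩
    refine LinearPMap.mem_domain_of_mem_graph (y := -lam j • b j) ?_
    rw [hA]
    intro k
    rw [map_smul, lp.coeFn_smul, Pi.smul_apply, b.repr_self, smul_eq_mul]
    rcases eq_or_ne k j with rfl | hkj
    · rfl
    · simp [lp.single_apply, hkj]
  have h2 : Dense (Submodule.span ℝ (Set.range b) : Set X) :=
    Submodule.dense_iff_topologicalClosure_eq_top.2 b.dense_span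
  exact h2.mono h1

/-! ### Moving one eigenvalue by a rank-one perturbation. -/

/-- The conjugate of a semigroup under an isomorphism. -/
def C0Semigroup.conj (S : C0Semigroup X) (T : X ≃L[ℝ] X) : C0Semigroup X where
  op t := (T.symm : X →L[ℝ] X).comp ((S.op t).comp (T : X →L[ℝ] X))
  op_zero := by
    ext x
    simp [S.op_zero]
  op_add s t hs ht := by
    ext x
    simp [S.op_add s t hs ht]
  strong x := by
    have := (T.symm.continuous.tendsto (T x)).comp (S.strong (T x))
    simpa [Function.comp_def] using this

theorem C0Semigroup.conj_generator (S : C0Semigroup X) (T : X ≃L[ℝ] X) (x y : X) :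
    Tendsto (fun t : ℝ => t⁻¹ • ((S.conj T).op t x - x)) (𝓝[>] 0) (𝓝 y) ↔
      Tendsto (fun t : ℝ => t⁻¹ • (S.op t (T x) - T x)) (𝓝[>] 0) (𝓝 (T y)) := by
  refine (T.toHomeomorph.isInducing.tendsto_nhds_iff).trans (tendsto_congr fun t => ?_)
  simp [C0Semigroup.conj]

theorem expStable_of_norm_le {V : Type*} [NormedAddCommGroup V] [NormedSpace ℝ V] (E : X →L[ℝ] V)
    (S : C0Semigroup X) {K c : ℝ} (hc : 0 < c)
    (h : ∀ t, 0 ≤ t → ‖S.op t‖ ≤ K * Real.exp (-c * t)) : ExpStable E S := by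
  refine ⟨max (‖E‖ * K) 1, c, by positivity, hc, fun t ht => ?_⟩
  refine (ContinuousLinearMap.opNorm_comp_le _ _).trans ?_
  refine (mul_le_mul_of_nonneg_left (h t ht) (norm_nonneg _)).trans ?_
  rw [← mul_assoc]
  exact mul_le_mul_of_nonneg_right (le_max_left _ _) (Real.exp_pos _).le

/-- The transvection `x ↦ x + g(x) v`, where `g(v) = 0`. -/
def transvection (g : X →L[ℝ] ℝ) (v : X) (h : g v = 0) : X ≃L[ℝ] X :=
  ContinuousLinearEquiv.equivOfInverse
    (ContinuousLinearMap.id ℝ X + g.smulRight v) (ContinuousLinearMap.id ℝ X - g.smulRight v)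
    (fun x => by simp [h]) (fun x => by simp [h])

theorem transvection_apply (g : X →L[ℝ] ℝ) (v : X) (h : g v = 0) (x : X) :
    transvection g v h x = x + g x • v := rfl

theorem repr_add_smul_basis [DecidableEq ι] (x : X) (c : ℝ) (j k : ι) :
    b.repr (x + c • b j) k = b.repr x k + if k = j then c else 0 := by
  rw [map_add, map_smul, lp.coeFn_add, Pi.add_apply, lp.coeFn_smul, Pi.smul_apply, b.repr_self]
  rcases eq_or_ne k j with rfl | hkj
  · simp
  · simp [lp.single_apply, hkj]

/-- Termwise comparison of Parseval series. It allows the unbounded factor `lam k` to be shifted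
from one argument of the inner product to the other, coordinate by coordinate. -/
theorem inner_eq_of_repr_mul_eq {u v u' v' : X}
    (h : ∀ k, b.repr u k * b.repr v k = b.repr u' k * b.repr v' k) :
    inner ℝ u v = inner ℝ u' v' := by
  rw [← b.tsum_inner_mul_inner u v, ← b.tsum_inner_mul_inner u' v']
  refine tsum_congr fun k => ?_
  have := h k
  simp only [b.repr_apply_apply] at this
  rw [real_inner_comm, this, real_inner_comm]

/-- A negative diagonal operator with an output `C` has a nonzero stabilizing gain. -/
theorem exists_stabilizing_gain [CompleteSpace X] [Nonempty ι] {c : ℝ} (hc : 0 < c)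
    (hcl : ∀ k, c ≤ lam k) {A : X →ₗ.[ℝ] X}
    (hA : ∀ x y, (x, y) ∈ A.graph ↔ ∀ k, b.repr y k = -lam k * b.repr x k)
    {V : Type*} [NormedAddCommGroup V] [NormedSpace ℝ V] (E : X →L[ℝ] V) (C : X →L[ℝ] ℝ) :
    ∃ H : ℝ →L[ℝ] X, H ≠ 0 ∧ GeneratesExpStable E (closedLoop A C H) := by
  classical
  have hlam : ∀ k, 0 < lam k := fun k => hc.trans_le (hcl k)
  have hbne : ∀ k, b k ≠ 0 := fun k => b.orthonormal.ne_zero k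
  have hHne : ∀ (r : ℝ) k, r ≠ 0 →
      (ContinuousLinearMap.id ℝ ℝ).smulRight (r • b k) ≠ (0 : ℝ →L[ℝ] X) := by
    intro r k hr h
    have := DFunLike.congr_fun h 1
    simp [hr, hbne] at this
  by_cases hC : ∀ k, C (b k) = 0
  · have hC0 : ∀ x, C x = 0 := fun x => by
      have h := (b.hasSum_repr x).mapL C
      simp only [map_smul, hC, smul_zero] at h
      exact h.unique hasSum_zero
    obtain ⟨k⟩ := ‹Nonempty ι›
    refine ⟨_, hHne 1 k one_ne_zero, diagSemigroup b hlam, fun x y => ?_,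
      expStable_of_norm_le E _ (K := 1) hc fun t ht => ?_⟩
    · rw [mem_graph_closedLoop, hC0, map_zero, add_zero]
      exact generates_diagSemigroup b hlam hA x y
    · rw [one_mul]
      exact norm_diagSemigroup_le b hlam hcl ht
  · push Not at hC
    obtain ⟨j, hj⟩ := hC
    -- The new `j`-th eigenvalue is `-ν`. Half of the spectral bound `c` lies strictly below every
    -- `lam k`, and `lam k - ν ≥ ν` keeps the denominators below away from zero.
    set ν := c / 2 with hν
    have hν0 : 0 < ν := by positivity
    -- Solves `-lam j - r * C (b j) = -ν`.
    set r := (ν - lam j) / C (b j) with hr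
    have hrC : r * C (b j) = ν - lam j := div_mul_cancel₀ _ hj
    have hgap : ∀ k, ν ≤ lam k - ν := fun k => by linarith [hcl k]
    have hr0 : r ≠ 0 := div_ne_zero (by linarith [hgap j]) hj
    set lam' : ι → ℝ := fun k => if k = j then ν else lam k with hlam'
    have hlam'ν : ∀ k, ν ≤ lam' k := fun k => by
      simp only [hlam']
      split_ifs
      · exact le_rfl
      · linarith [hgap k]
    have hlam'0 : ∀ k, 0 < lam' k := fun k => hν0.trans_le (hlam'ν k)
    set d : X := (InnerProductSpace.toDual ℝ X).symm C with hd
    have hdC : ∀ x, C x = inner ℝ d x := fun x => by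
      rw [hd, InnerProductSpace.toDual_symm_apply]
    have hdk : ∀ k, b.repr d k = C (b k) := fun k => by
      rw [b.repr_apply_apply, hdC, real_inner_comm]
    -- The map `T = 1 + ⟨g, ·⟩ b j` is to intertwine `A - HC` with the diagonal operator with
    -- eigenvalues `-lam'`. Comparing coefficients of `b j` gives `(ν - lam k) g_k = r C(b k)` for
    -- `k ≠ j`. The coordinate `g_j` is set to `0`, so that `T` is a transvection.
    set m : ι → ℝ := fun k => if k = j then 0 else r / (ν - lam k) with hm
    have hmb : ∀ k, |m k| ≤ |r| / ν := fun k => by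
      simp only [hm]
      split_ifs
      · rw [abs_zero]
        positivity
      · rw [abs_div]
        refine div_le_div_of_nonneg_left (abs_nonneg _) hν0 ?_
        rw [abs_sub_comm]
        exact (hgap k).trans (le_abs_self _)
    have hK : 0 ≤ |r| / ν := by positivity
    set g : X := diagOp b m hK hmb d with hg
    have hgj : innerSL ℝ g (b j) = 0 := by
      rw [innerSL_apply_apply, real_inner_comm, ← b.repr_apply_apply, hg, repr_diagOp]
      simp [hm]
    set T := transvection (innerSL ℝ g) (b j) hgj with hT
    refine ⟨_, hHne r j hr0, (diagSemigroup b hlam'0).conj T, fun x y => ?_,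
      expStable_of_norm_le E _ (K := ‖(T.symm : X →L[ℝ] X)‖ * ‖(T : X →L[ℝ] X)‖) hν0 fun t ht => ?_⟩
    · rw [mem_graph_closedLoop, C0Semigroup.conj_generator, ← diagSemigroup_generator, hA]
      have hTr : ∀ x k, b.repr (T x) k = b.repr x k + if k = j then inner ℝ g x else 0 := by
        intro x k
        rw [hT, transvection_apply, repr_add_smul_basis, innerSL_apply_apply]
      have hHr : ∀ k, b.repr (y + (ContinuousLinearMap.id ℝ ℝ).smulRight (r • b j) (C x)) k =
          b.repr y k + if k = j then C x * r else 0 := by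
        intro k
        rw [ContinuousLinearMap.smulRight_apply, smul_smul, repr_add_smul_basis]
        rfl
      -- This is the `b j`-coordinate of the intertwining relation. Since `g_j = 0`, it needs the
      -- eigenvalue equation only in the coordinates `k ≠ j`.
      have key : (∀ k, k ≠ j → b.repr y k = -lam k * b.repr x k) →
          inner ℝ g y + ν * inner ℝ g x = r * C x - (ν - lam j) * b.repr x j := by
        intro h
        have h1 : inner ℝ g (y + ν • x) = inner ℝ (r • d) (x + (-b.repr x j) • b j) := by
          refine inner_eq_of_repr_mul_eq b fun k => ?_
          rw [hg, repr_diagOp, repr_add_smul_basis, map_add, map_smul, map_smul, lp.coeFn_add,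
            Pi.add_apply, lp.coeFn_smul, Pi.smul_apply, lp.coeFn_smul, Pi.smul_apply,
            smul_eq_mul, smul_eq_mul]
          rcases eq_or_ne k j with rfl | hkj
          · simp [hm]
          · have : ν - lam k ≠ 0 := by linarith [hgap k]
            rw [h k hkj]
            simp only [hm, hkj, if_false]
            field_simp
            ring
        rw [inner_add_right, inner_smul_right, inner_smul_left, inner_add_right, inner_smul_right,
          ← hdC, ← hdC] at h1
        rw [h1, ← hrC]
        simp
        ring
      simp only [hTr, hHr]
      constructor
      · intro h k
        have h' : ∀ k, k ≠ j → b.repr y k = -lam k * b.repr x k := fun k hk => by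
          simpa [hk] using h k
        rcases eq_or_ne k j with rfl | hkj
        · have h1 := h k
          have h2 := key h'
          simp only [if_true, hlam'] at h1 ⊢
          linarith
        · simpa [hkj, hlam'] using h k
      · intro h k
        have h' : ∀ k, k ≠ j → b.repr y k = -lam k * b.repr x k := fun k hk => by
          simpa [hk, hlam'] using h k
        rcases eq_or_ne k j with rfl | hkj
        · have h1 := h k
          have h2 := key h'
          simp only [if_true, hlam'] at h1 ⊢
          linarith
        · simpa [hkj, hlam'] using h k
    · have h1 := norm_diagSemigroup_le b hlam'0 hlam'ν ht
      refine (ContinuousLinearMap.opNorm_comp_le _ _).trans ?_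
      rw [mul_assoc]
      refine mul_le_mul_of_nonneg_left ?_ (norm_nonneg _)
      refine (ContinuousLinearMap.opNorm_comp_le _ _).trans ?_
      rw [mul_comm]
      exact mul_le_mul_of_nonneg_left h1 (norm_nonneg _)

end Diagonal

/-! ### Calculus and Sobolev functions on the rectangle. -/

section Rectangle

/-! ### Products of functions of one variable -/

/-- The function `ξ ↦ g(ξ₁) h(ξ₂)`. -/
def prodFn (g h : ℝ → ℝ) (ξ : Plane) : ℝ := g (ξ 0) * h (ξ 1)

theorem contDiff_prodFn {g h : ℝ → ℝ} (hg : ContDiff ℝ (⊤ : ℕ∞) g) (hh : ContDiff ℝ (⊤ : ℕ∞) h) :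
    ContDiff ℝ (⊤ : ℕ∞) (prodFn g h) := by
  have h0 : ∀ i : Fin 2, ContDiff ℝ (⊤ : ℕ∞) fun ξ : Plane => ξ i := fun i =>
    (EuclideanSpace.proj (𝕜 := ℝ) i : Plane →L[ℝ] ℝ).contDiff
  exact (hg.comp (h0 0)).mul (hh.comp (h0 1))

theorem hasFDerivAt_prodFn {g h : ℝ → ℝ} {g' h' : ℝ} {ξ : Plane} (hg : HasDerivAt g g' (ξ 0))
    (hh : HasDerivAt h h' (ξ 1)) :
    HasFDerivAt (prodFn g h)
      (g (ξ 0) • (h' • (EuclideanSpace.proj 1 : Plane →L[ℝ] ℝ)) +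
        h (ξ 1) • (g' • (EuclideanSpace.proj 0 : Plane →L[ℝ] ℝ))) ξ := by
  have h0 : ∀ i : Fin 2, HasFDerivAt (fun ξ : Plane => ξ i)
      (EuclideanSpace.proj i : Plane →L[ℝ] ℝ) ξ := fun i =>
    (EuclideanSpace.proj (𝕜 := ℝ) i : Plane →L[ℝ] ℝ).hasFDerivAt
  exact (hg.comp_hasFDerivAt ξ (h0 0)).mul (hh.comp_hasFDerivAt ξ (h0 1))

theorem pderiv_zero_prodFn {g h g' h' : ℝ → ℝ} (hg : ∀ x, HasDerivAt g (g' x) x)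
    (hh : ∀ x, HasDerivAt h (h' x) x) : pderiv 0 (prodFn g h) = prodFn g' h := by
  funext ξ
  rw [pderiv, (hasFDerivAt_prodFn (hg _) (hh _)).fderiv]
  simp [prodFn, mul_comm]

theorem pderiv_one_prodFn {g h g' h' : ℝ → ℝ} (hg : ∀ x, HasDerivAt g (g' x) x)
    (hh : ∀ x, HasDerivAt h (h' x) x) : pderiv 1 (prodFn g h) = prodFn g h' := by
  funext ξ
  rw [pderiv, (hasFDerivAt_prodFn (hg _) (hh _)).fderiv]
  simp [prodFn]

theorem contDiff_pderiv {F : Plane → ℝ} (hF : ContDiff ℝ (⊤ : ℕ∞) F) (i : Fin 2) :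
    ContDiff ℝ (⊤ : ℕ∞) (pderiv i F) :=
  (hF.fderiv_right (m := (⊤ : ℕ∞)) (by simp)).clm_apply contDiff_const

theorem isCompact_box (l u : Fin 2 → ℝ) : IsCompact {ξ : Plane | ∀ i, ξ i ∈ Icc (l i) (u i)} := by
  have h := (EuclideanSpace.equiv (Fin 2) ℝ).toHomeomorph.isCompact_preimage.2
    (isCompact_univ_pi (X := fun _ : Fin 2 => ℝ) fun i => isCompact_Icc (a := l i) (b := u i))
  convert h using 1
  ext ξ
  rw [mem_preimage, mem_univ_pi]
  rfl

variable {a₁ a₂ : ℝ}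

theorem Rect_subset_box :
    Rect a₁ a₂ ⊆ {ξ : Plane | ∀ i, ξ i ∈ Icc ((![0, 0] : Fin 2 → ℝ) i) (![a₁, a₂] i)} := by
  intro ξ hξ i
  fin_cases i
  · exact ⟨hξ.1.1.le, hξ.1.2.le⟩
  · exact ⟨hξ.2.1.le, hξ.2.2.le⟩

instance : IsFiniteMeasure (volume.restrict (Rect a₁ a₂)) :=
  ⟨by
    rw [Measure.restrict_apply_univ]
    exact (measure_mono Rect_subset_box).trans_lt (isCompact_box _ _).measure_lt_top⟩

theorem exists_bound_on_Rect {F : Plane → ℝ} (hF : Continuous F) :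
    ∃ K : ℝ, ∀ ξ ∈ Rect a₁ a₂, |F ξ| ≤ K := by
  obtain ⟨K, hK⟩ := (isCompact_box ![0, 0] ![a₁, a₂]).exists_bound_of_continuousOn hF.continuousOn
  exact ⟨K, fun ξ hξ => hK ξ (Rect_subset_box hξ)⟩

theorem memLp_Rect {F : Plane → ℝ} (hF : Continuous F) :
    MemLp F 2 (volume.restrict (Rect a₁ a₂)) := by
  obtain ⟨K, hK⟩ := exists_bound_on_Rect (a₁ := a₁) (a₂ := a₂) hF
  exact MemLp.of_bound hF.aestronglyMeasurable K
    ((ae_restrict_mem (isOpen_Rect a₁ a₂).measurableSet).mono hK)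

theorem inner_toLp {F G : Plane → ℝ} {Ω : Set Plane} (hF : MemLp F 2 (volume.restrict Ω))
    (hG : MemLp G 2 (volume.restrict Ω)) :
    inner ℝ hF.toLp hG.toLp = ∫ ξ in Ω, F ξ * G ξ := by
  rw [L2.inner_def]
  refine integral_congr_ae ?_
  filter_upwards [hF.coeFn_toLp, hG.coeFn_toLp] with ξ h1 h2
  simp [h1, h2, mul_comm]

theorem integral_prodFn (g h : ℝ → ℝ) :
    ∫ ξ in Rect a₁ a₂, prodFn g h ξ = (∫ x in Ioo 0 a₁, g x) * ∫ x in Ioo 0 a₂, h x := by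
  let e : Plane ≃ᵐ ℝ × ℝ :=
    (MeasurableEquiv.toLp 2 (Fin 2 → ℝ)).symm.trans MeasurableEquiv.finTwoArrow
  have he : MeasurePreserving e volume volume :=
    (volume_preserving_finTwoArrow ℝ).comp
      (EuclideanSpace.volume_preserving_symm_measurableEquiv_toLp (Fin 2))
  have h1 := he.setIntegral_preimage_emb e.measurableEmbedding
    (fun p : ℝ × ℝ => g p.1 * h p.2) (Ioo 0 a₁ ×ˢ Ioo 0 a₂)
  have h2 : e ⁻¹' (Ioo 0 a₁ ×ˢ Ioo 0 a₂) = Rect a₁ a₂ := rfl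
  rw [h2] at h1
  rw [← setIntegral_prod_mul]
  exact h1

/-! ### Smooth functions as elements of the Sobolev spaces -/

/-- Test functions vanish outside a compact subset of `Ω`, so the integration by parts takes place
on the whole plane, without boundary terms and for any set `Ω`. -/
theorem isWeakDeriv_of_contDiff {Ω : Set Plane} {F : Plane → ℝ} (hF : ContDiff ℝ (⊤ : ℕ∞) F)
    (i : Fin 2) : IsWeakDeriv Ω i F (pderiv i F) := by
  intro φ hφ
  have h0 : ∀ ψ, IsTest Ω ψ → ∀ G : Plane → ℝ, ∫ ξ in Ω, ψ ξ * G ξ = ∫ ξ, ψ ξ * G ξ :=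
    fun ψ hψ G => setIntegral_eq_integral_of_forall_compl_eq_zero fun ξ hξ => by
      rw [image_eq_zero_of_notMem_tsupport (fun h' => hξ (hψ.supp h')), zero_mul]
  rw [h0 _ (hφ.pderiv i), h0 _ hφ]
  have hi : ∀ ψ, IsTest Ω ψ → ∀ G : Plane → ℝ, Continuous G → Integrable fun ξ => ψ ξ * G ξ :=
    fun ψ hψ G hG => (hψ.smooth.continuous.mul hG).integrable_of_hasCompactSupport
      hψ.compact.mul_right
  have h1 := integral_mul_fderiv_eq_neg_fderiv_mul_of_integrable (μ := volume) (f := φ) (g := F)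
    (v := EuclideanSpace.single i 1)
    (hi _ (hφ.pderiv i) F hF.continuous) (hi _ hφ _ (contDiff_pderiv hF i).continuous)
    (hi _ hφ F hF.continuous) (fun x _ => hφ.smooth.differentiable (by simp) x)
    (fun x _ => hF.differentiable (by simp) x)
  change _ = -∫ ξ, φ ξ * fderiv ℝ F ξ (EuclideanSpace.single i 1)
  rw [h1, neg_neg]
  rfl

/-- A smooth function as an element of `L²` of the rectangle. -/
def smoothL2 (a₁ a₂ : ℝ) {F : Plane → ℝ} (hF : ContDiff ℝ (⊤ : ℕ∞) F) : L2 (Rect a₁ a₂) :=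
  (memLp_Rect hF.continuous).toLp

theorem smoothL2_coe {F : Plane → ℝ} (hF : ContDiff ℝ (⊤ : ℕ∞) F) :
    (smoothL2 a₁ a₂ hF : Plane → ℝ) =ᵐ[volume.restrict (Rect a₁ a₂)] F :=
  MemLp.coeFn_toLp _

theorem inner_smoothL2 {F G : Plane → ℝ} (hF : ContDiff ℝ (⊤ : ℕ∞) F)
    (hG : ContDiff ℝ (⊤ : ℕ∞) G) :
    inner ℝ (smoothL2 a₁ a₂ hF) (smoothL2 a₁ a₂ hG) = ∫ ξ in Rect a₁ a₂, F ξ * G ξ :=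
  inner_toLp _ _

/-- A smooth function as an element of `H¹` of the rectangle. -/
def smoothH1 (a₁ a₂ : ℝ) {F : Plane → ℝ} (hF : ContDiff ℝ (⊤ : ℕ∞) F) : H1 (Rect a₁ a₂) :=
  ⟨WithLp.toLp 2 fun j => match j with
    | none => smoothL2 a₁ a₂ hF
    | some i => smoothL2 a₁ a₂ (contDiff_pderiv hF i), by
    intro i φ hφ
    have h := isWeakDeriv_of_contDiff (Ω := Rect a₁ a₂) hF i φ hφ
    have h1 : ∀ {G : Plane → ℝ} (hG : ContDiff ℝ (⊤ : ℕ∞) G) (ψ : Plane → ℝ),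
        ∫ ξ in Rect a₁ a₂, ψ ξ * smoothL2 a₁ a₂ hG ξ = ∫ ξ in Rect a₁ a₂, ψ ξ * G ξ := by
      intro G hG ψ
      refine integral_congr_ae ?_
      filter_upwards [smoothL2_coe (a₁ := a₁) (a₂ := a₂) hG] with ξ hξ
      rw [hξ]
    change ∫ ξ in Rect a₁ a₂, pderiv i φ ξ * smoothL2 a₁ a₂ hF ξ =
      -∫ ξ in Rect a₁ a₂, φ ξ * smoothL2 a₁ a₂ (contDiff_pderiv hF i) ξ
    rw [h1, h1, h]⟩

theorem val_smoothH1 {F : Plane → ℝ} (hF : ContDiff ℝ (⊤ : ℕ∞) F) :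
    H1.val (smoothH1 a₁ a₂ hF) = smoothL2 a₁ a₂ hF := rfl

theorem deriv_smoothH1 {F : Plane → ℝ} (hF : ContDiff ℝ (⊤ : ℕ∞) F) (i : Fin 2) :
    H1.deriv i (smoothH1 a₁ a₂ hF) = smoothL2 a₁ a₂ (contDiff_pderiv hF i) := rfl

theorem inner_H1 {Ω : Set Plane} (v w : H1 Ω) :
    inner ℝ v w = inner ℝ (H1.val v) (H1.val w) +
      (inner ℝ (H1.deriv 0 v) (H1.deriv 0 w) + inner ℝ (H1.deriv 1 v) (H1.deriv 1 w)) := by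
  change inner ℝ v.1 w.1 = _
  rw [PiLp.inner_apply, Fintype.sum_option, Fin.sum_univ_two]
  rfl

/-- Integration by parts in `H¹ × H¹₀`. -/
theorem inner_deriv_of_mem_H10 (v : H1 (Rect a₁ a₂)) {w : H1 (Rect a₁ a₂)}
    (hw : w ∈ H10 (Rect a₁ a₂)) (i : Fin 2) :
    inner ℝ (H1.deriv i v) (H1.val w) = -inner ℝ (H1.val v) (H1.deriv i w) := by
  have hclosed : IsClosed {w : H1 (Rect a₁ a₂) |
      inner ℝ (H1.deriv i v) (H1.val w) = -inner ℝ (H1.val v) (H1.deriv i w)} :=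
    isClosed_eq (by fun_prop) (by fun_prop)
  refine closure_minimal ?_ hclosed hw
  intro w hw
  refine Submodule.span_induction (p := fun w _ =>
    inner ℝ (H1.deriv i v) (H1.val w) = -inner ℝ (H1.val v) (H1.deriv i w)) ?_ ?_ ?_ ?_ hw
  -- For a test function the claim is the definition of the weak derivative of `v`; the rest of
  -- `H¹₀` follows by linearity and closure.
  · rintro w ⟨φ, hφ, hwφ⟩
    have hval : H1.val w = H1.val (smoothH1 a₁ a₂ hφ.smooth) :=
      Lp.ext (hwφ.trans (smoothL2_coe hφ.smooth).symm)
    have hw' : w = smoothH1 a₁ a₂ hφ.smooth := H1.val_injective (isOpen_Rect a₁ a₂) hval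
    have h := v.2 i φ hφ
    rw [integral_test_mul (hφ.pderiv i), integral_test_mul hφ] at h
    rw [hw', val_smoothH1, deriv_smoothH1, real_inner_comm, real_inner_comm (smoothL2 _ _ _)]
    have h' : inner ℝ (smoothL2 a₁ a₂ (contDiff_pderiv hφ.smooth i)) (H1.val v) =
        -inner ℝ (smoothL2 a₁ a₂ hφ.smooth) (H1.deriv i v) := h
    rw [h', neg_neg]
  · simp
  · intro x y _ _ hx hy
    simp only [map_add, inner_add_right, hx, hy]
    ring
  · intro c x _ hx
    simp only [map_smul, inner_smul_right, hx]
    ring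

theorem tendsto_smoothL2 {F : Plane → ℝ} (hF : ContDiff ℝ (⊤ : ℕ∞) F) {G : ℕ → Plane → ℝ}
    (hG : ∀ n, ContDiff ℝ (⊤ : ℕ∞) (G n)) (K : ℝ)
    (hK : ∀ n, ∀ ξ ∈ Rect a₁ a₂, |G n ξ| ≤ K)
    (hlim : ∀ ξ ∈ Rect a₁ a₂, Tendsto (fun n => G n ξ) atTop (𝓝 (F ξ))) :
    Tendsto (fun n => smoothL2 a₁ a₂ (hG n)) atTop (𝓝 (smoothL2 a₁ a₂ hF)) := by
  obtain ⟨K', hK'⟩ := exists_bound_on_Rect (a₁ := a₁) (a₂ := a₂) hF.continuous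
  have hsq : ∀ n, ‖smoothL2 a₁ a₂ (hG n) - smoothL2 a₁ a₂ hF‖ ^ 2 =
      ∫ ξ in Rect a₁ a₂, (G n ξ - F ξ) * (G n ξ - F ξ) := fun n => by
    rw [← real_inner_self_eq_norm_sq, smoothL2, smoothL2, ← MemLp.toLp_sub, inner_toLp]
    rfl
  have hmem := ae_restrict_mem (μ := volume) (isOpen_Rect a₁ a₂).measurableSet
  have h1 : Tendsto (fun n => ∫ ξ in Rect a₁ a₂, (G n ξ - F ξ) * (G n ξ - F ξ)) atTop
      (𝓝 (∫ _ in Rect a₁ a₂, (0 : ℝ))) := by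
    refine tendsto_integral_of_dominated_convergence (fun _ => (K + K') * (K + K')) (fun n => ?_)
      (integrable_const _) (fun n => ?_) ?_
    · have := ((hG n).continuous.sub hF.continuous)
      exact (this.mul this).aestronglyMeasurable
    · refine hmem.mono fun ξ hξ => ?_
      have h2 : |G n ξ - F ξ| ≤ K + K' :=
        (abs_sub _ _).trans (add_le_add (hK n ξ hξ) (hK' ξ hξ))
      rw [norm_mul, Real.norm_eq_abs]
      exact mul_le_mul h2 h2 (abs_nonneg _) ((abs_nonneg _).trans h2)
    · refine hmem.mono fun ξ hξ => ?_
      have h2 := (hlim ξ hξ).sub_const (F ξ)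
      simpa using h2.mul h2
  rw [integral_zero] at h1
  rw [tendsto_iff_norm_sub_tendsto_zero]
  have h3 := (Real.continuous_sqrt.tendsto 0).comp (h1.congr fun n => (hsq n).symm)
  simpa [Function.comp_def] using h3

theorem tendsto_smoothH1 {F : Plane → ℝ} (hF : ContDiff ℝ (⊤ : ℕ∞) F) {G : ℕ → Plane → ℝ}
    (hG : ∀ n, ContDiff ℝ (⊤ : ℕ∞) (G n))
    (h0 : Tendsto (fun n => smoothL2 a₁ a₂ (hG n)) atTop (𝓝 (smoothL2 a₁ a₂ hF)))
    (h1 : ∀ i, Tendsto (fun n => smoothL2 a₁ a₂ (contDiff_pderiv (hG n) i)) atTop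
      (𝓝 (smoothL2 a₁ a₂ (contDiff_pderiv hF i)))) :
    Tendsto (fun n => smoothH1 a₁ a₂ (hG n)) atTop (𝓝 (smoothH1 a₁ a₂ hF)) := by
  refine tendsto_subtype_rng.2 ?_
  refine ((PiLp.continuous_toLp 2 _).tendsto _).comp (tendsto_pi_nhds.2 fun j => ?_)
  cases j with
  | none => exact h0
  | some i => exact h1 i

/-! ### Cutting off near the boundary -/

/-- A smooth cutoff function on `[0, a]`, equal to `1` on `[2 / n, a - 2 / n]` and to `0` outside
`[1 / n, a - 1 / n]`. -/
def cutoff (a : ℝ) (n : ℕ) (x : ℝ) : ℝ :=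
  Real.smoothTransition (n * x - 1) * Real.smoothTransition (n * (a - x) - 1)

theorem contDiff_cutoff (a : ℝ) (n : ℕ) : ContDiff ℝ (⊤ : ℕ∞) (cutoff a n) :=
  (Real.smoothTransition.contDiff.comp (by fun_prop)).mul
    (Real.smoothTransition.contDiff.comp (by fun_prop))

theorem abs_cutoff_le (a : ℝ) (n : ℕ) (x : ℝ) : |cutoff a n x| ≤ 1 := by
  rw [cutoff, abs_of_nonneg (mul_nonneg (Real.smoothTransition.nonneg _)
    (Real.smoothTransition.nonneg _))]
  exact mul_le_one₀ (Real.smoothTransition.le_one _) (Real.smoothTransition.nonneg _)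
    (Real.smoothTransition.le_one _)

theorem deriv_smoothTransition_eq_zero {y : ℝ} (hy : y < 0 ∨ 1 < y) :
    deriv Real.smoothTransition y = 0 := by
  rcases hy with hy | hy
  · have : Real.smoothTransition =ᶠ[𝓝 y] fun _ => 0 := by
      filter_upwards [Iio_mem_nhds hy] with z hz
      exact Real.smoothTransition.zero_of_nonpos (le_of_lt hz)
    rw [this.deriv_eq, deriv_const]
  · have : Real.smoothTransition =ᶠ[𝓝 y] fun _ => 1 := by
      filter_upwards [Ioi_mem_nhds hy] with z hz
      exact Real.smoothTransition.one_of_one_le (le_of_lt hz)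
    rw [this.deriv_eq, deriv_const]

/-- The derivative is supported where `y ∈ [1, 2]`. Taking `y = n * x` bounds `n * x * deriv`
independently of `n`, which absorbs the factor `n` in `cutoffDeriv`. -/
theorem exists_bound_mul_deriv_smoothTransition :
    ∃ D : ℝ, ∀ y, |y * deriv Real.smoothTransition (y - 1)| ≤ D := by
  have hc : Continuous fun y : ℝ => y * deriv Real.smoothTransition (y - 1) :=
    continuous_id.mul (((Real.smoothTransition.contDiff (n := 1)).continuous_deriv
      le_rfl).comp (by fun_prop))
  obtain ⟨D, hD⟩ := (isCompact_Icc (a := (1 : ℝ)) (b := 2)).exists_bound_of_continuousOn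
    hc.continuousOn
  refine ⟨D, fun y => ?_⟩
  by_cases hy : y ∈ Icc (1 : ℝ) 2
  · exact hD y hy
  · rw [deriv_smoothTransition_eq_zero, mul_zero, abs_zero]
    · exact (norm_nonneg _).trans (hD 1 ⟨le_rfl, by norm_num⟩)
    · by_contra! h
      exact hy ⟨by linarith, by linarith⟩

/-- The derivative of `cutoff a n`. -/
def cutoffDeriv (a : ℝ) (n : ℕ) (x : ℝ) : ℝ :=
  n * deriv Real.smoothTransition (n * x - 1) * Real.smoothTransition (n * (a - x) - 1) +
    Real.smoothTransition (n * x - 1) * (-n * deriv Real.smoothTransition (n * (a - x) - 1))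

theorem hasDerivAt_cutoff (a : ℝ) (n : ℕ) (x : ℝ) :
    HasDerivAt (cutoff a n) (cutoffDeriv a n x) x := by
  have hs : ∀ y, HasDerivAt Real.smoothTransition (deriv Real.smoothTransition y) y := fun y =>
    ((Real.smoothTransition.contDiff (n := 1)).differentiable (by simp) y).hasDerivAt
  have h1 : HasDerivAt (fun x : ℝ => (n : ℝ) * x - 1) (n : ℝ) x := by
    simpa using ((hasDerivAt_id x).const_mul (n : ℝ)).sub_const 1
  have h2 : HasDerivAt (fun x : ℝ => (n : ℝ) * (a - x) - 1) (-n : ℝ) x := by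
    simpa using (((hasDerivAt_id x).const_sub a).const_mul (n : ℝ)).sub_const 1
  have h3 := ((hs _).comp x h1).mul ((hs _).comp x h2)
  refine h3.congr_deriv ?_
  simp only [cutoffDeriv, Function.comp_apply]
  ring

theorem tendsto_cutoff {a x : ℝ} (hx : x ∈ Ioo 0 a) :
    ∀ᶠ n : ℕ in atTop, cutoff a n x = 1 ∧ cutoffDeriv a n x = 0 := by
  have h1 : Tendsto (fun n : ℕ => (n : ℝ) * x - 1) atTop atTop :=
    tendsto_atTop_add_const_right _ _ (tendsto_natCast_atTop_atTop.atTop_mul_const hx.1)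
  have h2 : Tendsto (fun n : ℕ => (n : ℝ) * (a - x) - 1) atTop atTop :=
    tendsto_atTop_add_const_right _ _
      (tendsto_natCast_atTop_atTop.atTop_mul_const (sub_pos.2 hx.2))
  filter_upwards [h1.eventually_gt_atTop 1, h2.eventually_gt_atTop 1] with n hn1 hn2
  rw [cutoff, cutoffDeriv, Real.smoothTransition.one_of_one_le hn1.le,
    Real.smoothTransition.one_of_one_le hn2.le, deriv_smoothTransition_eq_zero (Or.inr hn1),
    deriv_smoothTransition_eq_zero (Or.inr hn2)]
  simp

theorem cutoff_eq_zero {a x : ℝ} {n : ℕ} (hn : 0 < n)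
    (hx : x ∉ Icc (1 / (n : ℝ)) (a - 1 / n)) : cutoff a n x = 0 := by
  have hn' : (0 : ℝ) < n := by exact_mod_cast hn
  rw [mem_Icc, not_and_or, not_le, not_le] at hx
  rw [cutoff]
  rcases hx with hx | hx
  · rw [lt_div_iff₀ hn'] at hx
    rw [Real.smoothTransition.zero_of_nonpos (by linarith), zero_mul]
  · have : a - x < 1 / n := by linarith
    rw [lt_div_iff₀ hn'] at this
    rw [Real.smoothTransition.zero_of_nonpos (x := n * (a - x) - 1) (by linarith), mul_zero]

/-- Because `g` vanishes at both ends, `|g|` is at most `L` times the distance to either end. This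
compensates the growth of `cutoffDeriv` there, so `K` does not depend on `n` and can serve as a
dominating constant. -/
theorem exists_bound_cutoff_mul {a : ℝ} {g g' : ℝ → ℝ} (hg : ∀ x, HasDerivAt g (g' x) x)
    (hg' : Continuous g') (h0 : g 0 = 0) (ha : g a = 0) :
    ∃ K : ℝ, ∀ n : ℕ, ∀ x ∈ Ioo 0 a, |g x * cutoff a n x| ≤ K ∧
      |g' x * cutoff a n x + g x * cutoffDeriv a n x| ≤ K := by
  obtain ⟨L, hL⟩ := (isCompact_Icc (a := (0 : ℝ)) (b := a)).exists_bound_of_continuousOn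
    hg'.continuousOn
  obtain ⟨D, hD⟩ := exists_bound_mul_deriv_smoothTransition
  refine ⟨max (L * a) (L + (L * D + L * D)), fun n x hx => ?_⟩
  have hL0 : 0 ≤ L := (norm_nonneg _).trans (hL x ⟨hx.1.le, hx.2.le⟩)
  have hconv : Convex ℝ (Icc 0 a) := convex_Icc 0 a
  have hlip : ∀ y ∈ Icc 0 a, |g x - g y| ≤ L * |x - y| := fun y hy =>
    hconv.norm_image_sub_le_of_norm_hasDerivWithin_le
      (fun z _ => (hg z).hasDerivWithinAt) hL hy ⟨hx.1.le, hx.2.le⟩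
  have ha0 : 0 ≤ a := (hx.1.trans hx.2).le
  have h1 : |g x| ≤ L * x := by
    have := hlip 0 ⟨le_rfl, ha0⟩
    rwa [h0, sub_zero, sub_zero, abs_of_pos hx.1] at this
  have h2 : |g x| ≤ L * (a - x) := by
    have := hlip a ⟨ha0, le_rfl⟩
    rwa [ha, sub_zero, abs_sub_comm, abs_of_pos (sub_pos.2 hx.2)] at this
  have hn : (0 : ℝ) ≤ n := Nat.cast_nonneg n
  constructor
  · refine le_max_of_le_left ?_
    rw [abs_mul]
    refine (mul_le_mul h1 (abs_cutoff_le a n x) (abs_nonneg _) (mul_nonneg hL0 hx.1.le)).trans ?_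
    rw [mul_one]
    exact mul_le_mul_of_nonneg_left hx.2.le hL0
  · refine le_max_of_le_right ((abs_add_le _ _).trans (add_le_add ?_ ?_))
    · rw [abs_mul]
      exact (mul_le_mul (hL x ⟨hx.1.le, hx.2.le⟩) (abs_cutoff_le a n x) (abs_nonneg _) hL0).trans
        (mul_one L).le
    · have key : ∀ y d s : ℝ, 0 ≤ y → |g x| ≤ L * y → |n * y * d| ≤ D → |s| ≤ 1 →
          |g x * (n * d * s)| ≤ L * D := by
        intro y d s hy h3 h4 h5
        calc |g x * (n * d * s)| = |g x| * (|n * d| * |s|) := by rw [abs_mul, abs_mul (_ * _)]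
          _ ≤ (L * y) * (|n * d| * 1) := by gcongr
          _ = L * |n * y * d| := by
            rw [abs_mul, abs_mul, abs_mul, abs_of_nonneg hy]; ring
          _ ≤ L * D := by gcongr
      have hs : ∀ z, |Real.smoothTransition z| ≤ 1 := fun z => by
        rw [abs_of_nonneg (Real.smoothTransition.nonneg z)]
        exact Real.smoothTransition.le_one z
      rw [cutoffDeriv, mul_add]
      refine (abs_add_le _ _).trans (add_le_add ?_ ?_)
      · exact key x _ _ hx.1.le h1 (hD (n * x)) (hs _)
      · have := key (a - x) _ _ (sub_nonneg.2 hx.2.le) h2 (hD (n * (a - x))) (hs (n * x - 1))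
        rw [← abs_neg]
        refine le_of_eq_of_le ?_ this
        congr 1
        ring

/-- A smooth product which vanishes on the boundary of the rectangle lies in `H¹₀`. -/
theorem smoothH1_prodFn_mem_H10 {g h g' h' : ℝ → ℝ} (hg : ContDiff ℝ (⊤ : ℕ∞) g)
    (hh : ContDiff ℝ (⊤ : ℕ∞) h) (hdg : ∀ x, HasDerivAt g (g' x) x)
    (hdh : ∀ x, HasDerivAt h (h' x) x) (hcg : Continuous g') (hch : Continuous h')
    (hg0 : g 0 = 0) (hga : g a₁ = 0) (hh0 : h 0 = 0) (hha : h a₂ = 0) :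
    smoothH1 a₁ a₂ (contDiff_prodFn hg hh) ∈ H10 (Rect a₁ a₂) := by
  -- The shift to `n + 1` keeps the margin `1 / (n + 1)` meaningful, as `cutoff_eq_zero` needs a
  -- positive index.
  set G : ℕ → ℝ → ℝ := fun n x => g x * cutoff a₁ (n + 1) x with hG
  set H : ℕ → ℝ → ℝ := fun n x => h x * cutoff a₂ (n + 1) x with hH
  set G' : ℕ → ℝ → ℝ := fun n x =>
    g' x * cutoff a₁ (n + 1) x + g x * cutoffDeriv a₁ (n + 1) x with hG'
  set H' : ℕ → ℝ → ℝ := fun n x =>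
    h' x * cutoff a₂ (n + 1) x + h x * cutoffDeriv a₂ (n + 1) x with hH'
  have hGs : ∀ n, ContDiff ℝ (⊤ : ℕ∞) (G n) := fun n => hg.mul (contDiff_cutoff _ _)
  have hHs : ∀ n, ContDiff ℝ (⊤ : ℕ∞) (H n) := fun n => hh.mul (contDiff_cutoff _ _)
  have hGd : ∀ n x, HasDerivAt (G n) (G' n x) x := fun n x =>
    (hdg x).mul (hasDerivAt_cutoff a₁ (n + 1) x)
  have hHd : ∀ n x, HasDerivAt (H n) (H' n x) x := fun n x =>
    (hdh x).mul (hasDerivAt_cutoff a₂ (n + 1) x)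
  obtain ⟨K, hK⟩ := exists_bound_cutoff_mul hdg hcg hg0 hga
  obtain ⟨K', hK'⟩ := exists_bound_cutoff_mul hdh hch hh0 hha
  have hlimG : ∀ x ∈ Ioo 0 a₁, Tendsto (fun n => G n x) atTop (𝓝 (g x)) ∧
      Tendsto (fun n => G' n x) atTop (𝓝 (g' x)) := fun x hx => by
    have h1 := (tendsto_add_atTop_nat 1).eventually (tendsto_cutoff hx)
    constructor <;> refine tendsto_const_nhds.congr' ?_ <;> filter_upwards [h1] with n hn <;>
      simp [hG, hG', hn.1, hn.2]
  have hlimH : ∀ x ∈ Ioo 0 a₂, Tendsto (fun n => H n x) atTop (𝓝 (h x)) ∧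
      Tendsto (fun n => H' n x) atTop (𝓝 (h' x)) := fun x hx => by
    have h1 := (tendsto_add_atTop_nat 1).eventually (tendsto_cutoff hx)
    constructor <;> refine tendsto_const_nhds.congr' ?_ <;> filter_upwards [h1] with n hn <;>
      simp [hH, hH', hn.1, hn.2]
  have hbound : ∀ {p q : ℝ}, |p| ≤ K → |q| ≤ K' → |p * q| ≤ K * K' := fun hp hq => by
    rw [abs_mul]
    exact mul_le_mul hp hq (abs_nonneg _) ((abs_nonneg _).trans hp)
  have hF := fun n => contDiff_prodFn (hGs n) (hHs n)
  have hconv : Tendsto (fun n => smoothH1 a₁ a₂ (hF n)) atTop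
      (𝓝 (smoothH1 a₁ a₂ (contDiff_prodFn hg hh))) := by
    refine tendsto_smoothH1 _ _ ?_ fun i => ?_
    · refine tendsto_smoothL2 _ _ (K * K') (fun n ξ hξ => ?_) fun ξ hξ => ?_
      · exact hbound (hK _ _ hξ.1).1 (hK' _ _ hξ.2).1
      · exact (hlimG _ hξ.1).1.mul (hlimH _ hξ.2).1
    · fin_cases i
      · refine tendsto_smoothL2 _ _ (K * K') (fun n ξ hξ => ?_) fun ξ hξ => ?_
        · change |pderiv 0 (prodFn (G n) (H n)) ξ| ≤ _
          rw [pderiv_zero_prodFn (hGd n) (hHd n)]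
          exact hbound (hK _ _ hξ.1).2 (hK' _ _ hξ.2).1
        · change Tendsto (fun n => pderiv 0 (prodFn (G n) (H n)) ξ) _ (𝓝 (pderiv 0 _ ξ))
          simp_rw [pderiv_zero_prodFn (hGd _) (hHd _), pderiv_zero_prodFn hdg hdh]
          exact (hlimG _ hξ.1).2.mul (hlimH _ hξ.2).1
      · refine tendsto_smoothL2 _ _ (K * K') (fun n ξ hξ => ?_) fun ξ hξ => ?_
        · change |pderiv 1 (prodFn (G n) (H n)) ξ| ≤ _
          rw [pderiv_one_prodFn (hGd n) (hHd n)]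
          exact hbound (hK _ _ hξ.1).1 (hK' _ _ hξ.2).2
        · change Tendsto (fun n => pderiv 1 (prodFn (G n) (H n)) ξ) _ (𝓝 (pderiv 1 _ ξ))
          simp_rw [pderiv_one_prodFn (hGd _) (hHd _), pderiv_one_prodFn hdg hdh]
          exact (hlimG _ hξ.1).1.mul (hlimH _ hξ.2).2
  refine mem_closure_of_tendsto hconv (Eventually.of_forall fun n => Submodule.subset_span ?_)
  refine ⟨prodFn (G n) (H n), ⟨hF n, ?_, ?_⟩, smoothL2_coe (hF n)⟩
  -- Each approximant is supported in a closed box at distance `1 / (n + 1)` from the sides, so it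
  -- is a genuine test function.
  all_goals
    have hn : (0 : ℝ) < 1 / ((n + 1 : ℕ) : ℝ) := by positivity
    have hsupp : Function.support (prodFn (G n) (H n)) ⊆
        {ξ : Plane | ∀ i, ξ i ∈ Icc ((fun _ => 1 / ((n + 1 : ℕ) : ℝ)) i)
          ((![a₁ - 1 / ((n + 1 : ℕ) : ℝ), a₂ - 1 / ((n + 1 : ℕ) : ℝ)] : Fin 2 → ℝ) i)} := by
      intro ξ hξ i
      by_contra hi
      refine hξ ?_
      fin_cases i
      · have h0 : cutoff a₁ (n + 1) (ξ 0) = 0 := cutoff_eq_zero n.succ_pos hi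
        simp [prodFn, hG, h0]
      · have h0 : cutoff a₂ (n + 1) (ξ 1) = 0 := cutoff_eq_zero n.succ_pos hi
        simp [prodFn, hH, h0]
  · exact HasCompactSupport.of_support_subset_isCompact (isCompact_box _ _) hsupp
  · refine (closure_minimal hsupp (isCompact_box _ _).isClosed).trans fun ξ hξ => ?_
    have h0 := hξ 0
    have h1 := hξ 1
    simp only [Matrix.cons_val_zero, Matrix.cons_val_one] at h0 h1
    exact ⟨⟨hn.trans_le h0.1, by linarith [h0.2]⟩, ⟨hn.trans_le h1.1, by linarith [h1.2]⟩⟩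

end Rectangle

section Eigenfunctions

/-! ### Trigonometric functions -/

/-- The `m`-th derivative of `x ↦ sin (κ x)`. -/
def trig (κ : ℝ) (m : ℕ) (x : ℝ) : ℝ := κ ^ m * Real.sin (κ * x + m * (Real.pi / 2))

theorem hasDerivAt_trig (κ : ℝ) (m : ℕ) (x : ℝ) : HasDerivAt (trig κ m) (trig κ (m + 1) x) x := by
  have h1 : HasDerivAt (fun x : ℝ => κ * x + m * (Real.pi / 2)) κ x := by
    simpa using ((hasDerivAt_id x).const_mul κ).add_const (m * (Real.pi / 2))
  refine (h1.sin.const_mul (κ ^ m)).congr_deriv ?_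
  have h2 : κ * x + ((m + 1 : ℕ) : ℝ) * (Real.pi / 2) =
      κ * x + m * (Real.pi / 2) + Real.pi / 2 := by push_cast; ring
  rw [trig, h2, Real.sin_add_pi_div_two, pow_succ]
  ring

theorem contDiff_trig (κ : ℝ) (m : ℕ) : ContDiff ℝ (⊤ : ℕ∞) (trig κ m) :=
  contDiff_const.mul (Real.contDiff_sin.comp (by fun_prop))

theorem trig_zero (κ x : ℝ) : trig κ 0 x = Real.sin (κ * x) := by simp [trig]

theorem trig_two (κ x : ℝ) : trig κ 2 x = -κ ^ 2 * trig κ 0 x := by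
  have : κ * x + ((2 : ℕ) : ℝ) * (Real.pi / 2) = κ * x + Real.pi := by push_cast; ring
  rw [trig, this, Real.sin_add_pi, trig_zero]
  ring

/-- The frequencies of the Dirichlet eigenfunctions of the interval `[0, a]`. -/
def freq (a : ℝ) (n : ℕ) : ℝ := ((n : ℝ) + 1) * Real.pi / a

variable {a : ℝ}

theorem freq_pos (ha : 0 < a) (n : ℕ) : 0 < freq a n := by
  have := Real.pi_pos
  unfold freq
  positivity

theorem freq_mul (ha : 0 < a) (n : ℕ) : freq a n * a = ((n : ℝ) + 1) * Real.pi :=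
  div_mul_cancel₀ _ ha.ne'

theorem sin_mul_pi_add (z : ℤ) (m : ℕ) : Real.sin (z * Real.pi + m * Real.pi) = 0 := by
  rw [← add_mul]
  have : (z : ℝ) + m = ((z + m : ℤ) : ℝ) := by push_cast; rfl
  rw [this, Real.sin_int_mul_pi]

theorem trig_mul_trig (κ κ' : ℝ) (m : ℕ) (x : ℝ) : trig κ m x * trig κ' m x =
    κ ^ m * κ' ^ m * ((Real.cos ((κ - κ') * x) - Real.cos ((κ + κ') * x + m * Real.pi)) / 2) := by
  have h1 : (κ - κ') * x = (κ * x + m * (Real.pi / 2)) - (κ' * x + m * (Real.pi / 2)) := by ring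
  have h2 : (κ + κ') * x + m * Real.pi =
      (κ * x + m * (Real.pi / 2)) + (κ' * x + m * (Real.pi / 2)) := by ring
  rw [trig, trig, h1, h2]
  generalize κ * x + m * (Real.pi / 2) = A
  generalize κ' * x + m * (Real.pi / 2) = B
  rw [Real.cos_sub, Real.cos_add]
  ring

/-- By the product-to-sum formula only cosines of the sum and the difference of the frequencies
appear. These frequencies times `a` are integer multiples of `π`, so the integrals vanish, except
for the constant difference term when `n = n'`. All orders `m` are needed to compute inner products
in the state space. -/
theorem integral_trig (ha : 0 < a) (m n n' : ℕ) :
    ∫ x in Ioo 0 a, trig (freq a n) m x * trig (freq a n') m x =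
      if n = n' then freq a n ^ (2 * m) * (a / 2) else 0 := by
  rw [← integral_Ioc_eq_integral_Ioo, ← intervalIntegral.integral_of_le ha.le]
  simp_rw [trig_mul_trig]
  rw [intervalIntegral.integral_const_mul, intervalIntegral.integral_div,
    intervalIntegral.integral_sub
      ((by fun_prop : Continuous _).intervalIntegrable _ _)
      ((by fun_prop : Continuous _).intervalIntegrable _ _)]
  have hp := freq_pos ha n
  have hp' := freq_pos ha n'
  have hs : ∫ x in (0 : ℝ)..a, Real.cos ((freq a n + freq a n') * x + m * Real.pi) = 0 := by
    rw [intervalIntegral.integral_comp_mul_add Real.cos (add_pos hp hp').ne', integral_cos]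
    have h1 : (freq a n + freq a n') * a + m * Real.pi =
        ((n + 1 + (n' + 1) : ℤ) : ℝ) * Real.pi + m * Real.pi := by
      rw [add_mul, freq_mul ha, freq_mul ha]
      push_cast
      ring
    rw [h1, sin_mul_pi_add, mul_zero, zero_add, Real.sin_nat_mul_pi]
    simp
  rw [hs]
  split_ifs with h
  · subst h
    simp only [sub_self, zero_mul, Real.cos_zero, intervalIntegral.integral_const, smul_eq_mul]
    ring
  · have hne : freq a n - freq a n' ≠ 0 := by
      intro h0
      apply h
      have h1 : freq a n * a = freq a n' * a := by rw [sub_eq_zero.1 h0]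
      rw [freq_mul ha, freq_mul ha] at h1
      have h2 := mul_right_cancel₀ Real.pi_ne_zero h1
      exact_mod_cast add_right_cancel h2
    rw [intervalIntegral.integral_comp_mul_left Real.cos hne, integral_cos, mul_zero, Real.sin_zero]
    have h1 : (freq a n - freq a n') * a = ((n - n' : ℤ) : ℝ) * Real.pi := by
      rw [sub_mul, freq_mul ha, freq_mul ha]
      push_cast
      ring
    rw [h1, Real.sin_int_mul_pi]
    simp

/-! ### Eigenfunctions of the rectangle -/

variable {a₁ a₂ : ℝ}

/-- The `m₁`-th derivative in the first variable and `m₂`-th derivative in the second variable of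
the eigenfunction with index `k`. -/
def mode (a₁ a₂ : ℝ) (m₁ m₂ : ℕ) (k : ℕ × ℕ) : Plane → ℝ :=
  prodFn (trig (freq a₁ k.1) m₁) (trig (freq a₂ k.2) m₂)

theorem contDiff_mode (m₁ m₂ : ℕ) (k : ℕ × ℕ) : ContDiff ℝ (⊤ : ℕ∞) (mode a₁ a₂ m₁ m₂ k) :=
  contDiff_prodFn (contDiff_trig _ _) (contDiff_trig _ _)

theorem pderiv_zero_mode (m₁ m₂ : ℕ) (k : ℕ × ℕ) :
    pderiv 0 (mode a₁ a₂ m₁ m₂ k) = mode a₁ a₂ (m₁ + 1) m₂ k :=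
  pderiv_zero_prodFn (hasDerivAt_trig _ _) (hasDerivAt_trig _ _)

theorem pderiv_one_mode (m₁ m₂ : ℕ) (k : ℕ × ℕ) :
    pderiv 1 (mode a₁ a₂ m₁ m₂ k) = mode a₁ a₂ m₁ (m₂ + 1) k :=
  pderiv_one_prodFn (hasDerivAt_trig _ _) (hasDerivAt_trig _ _)

/-- The functions `mode` as elements of `L²`. -/
def modeL2 (a₁ a₂ : ℝ) (m₁ m₂ : ℕ) (k : ℕ × ℕ) : L2 (Rect a₁ a₂) :=
  smoothL2 a₁ a₂ (contDiff_mode (a₁ := a₁) (a₂ := a₂) m₁ m₂ k)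

theorem smoothL2_congr {F G : Plane → ℝ} (hF : ContDiff ℝ (⊤ : ℕ∞) F) (hG : ContDiff ℝ (⊤ : ℕ∞) G)
    (h : F = G) : smoothL2 a₁ a₂ hF = smoothL2 a₁ a₂ hG := by
  subst h
  rfl

theorem inner_modeL2 (ha₁ : 0 < a₁) (ha₂ : 0 < a₂) (m₁ m₂ : ℕ) (k l : ℕ × ℕ) :
    inner ℝ (modeL2 a₁ a₂ m₁ m₂ k) (modeL2 a₁ a₂ m₁ m₂ l) =
      if k = l then freq a₁ k.1 ^ (2 * m₁) * freq a₂ k.2 ^ (2 * m₂) * (a₁ * a₂ / 4) else 0 := by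
  rw [modeL2, modeL2, inner_smoothL2]
  have h : ∀ ξ, mode a₁ a₂ m₁ m₂ k ξ * mode a₁ a₂ m₁ m₂ l ξ =
      prodFn (fun x => trig (freq a₁ k.1) m₁ x * trig (freq a₁ l.1) m₁ x)
        (fun x => trig (freq a₂ k.2) m₂ x * trig (freq a₂ l.2) m₂ x) ξ := fun ξ => by
    simp only [mode, prodFn]
    ring
  simp_rw [h]
  rw [integral_prodFn, integral_trig ha₁, integral_trig ha₂]
  rcases eq_or_ne k l with rfl | hkl
  · simp
    ring
  · rw [if_neg hkl]
    split_ifs with h1 h2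
    · exact absurd (Prod.ext h1 h2) hkl
    all_goals simp

/-- The eigenvalues of `-Δ`. -/
def eigval (a₁ a₂ : ℝ) (k : ℕ × ℕ) : ℝ := freq a₁ k.1 ^ 2 + freq a₂ k.2 ^ 2

theorem eigval_pos (ha₁ : 0 < a₁) (k : ℕ × ℕ) : 0 < eigval a₁ a₂ k := by
  have := freq_pos ha₁ k.1
  unfold eigval
  positivity

theorem mode_mem_H10 (ha₁ : 0 < a₁) (ha₂ : 0 < a₂) (k : ℕ × ℕ) :
    smoothH1 a₁ a₂ (contDiff_mode (a₁ := a₁) (a₂ := a₂) 0 0 k) ∈ H10 (Rect a₁ a₂) := by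
  have h0 : ∀ {a : ℝ} (n : ℕ), trig (freq a n) 0 0 = 0 := fun n => by simp [trig]
  have h1 : ∀ {a : ℝ} (_ : 0 < a) (n : ℕ), trig (freq a n) 0 a = 0 := fun ha n => by
    rw [trig_zero, freq_mul ha]
    exact_mod_cast Real.sin_nat_mul_pi (n + 1)
  exact smoothH1_prodFn_mem_H10 (contDiff_trig _ _) (contDiff_trig _ _) (hasDerivAt_trig _ _)
    (hasDerivAt_trig _ _) (contDiff_trig _ _).continuous (contDiff_trig _ _).continuous
    (h0 _) (h1 ha₁ _) (h0 _) (h1 ha₂ _)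

theorem smoothL2_pderiv_zero_pderiv_zero (k : ℕ × ℕ) :
    smoothL2 a₁ a₂ (contDiff_pderiv (contDiff_pderiv
      (contDiff_mode (a₁ := a₁) (a₂ := a₂) 0 0 k) 0) 0) = modeL2 a₁ a₂ 2 0 k :=
  smoothL2_congr _ _ (by rw [pderiv_zero_mode, pderiv_zero_mode])

theorem smoothL2_pderiv_one_pderiv_one (k : ℕ × ℕ) :
    smoothL2 a₁ a₂ (contDiff_pderiv (contDiff_pderiv
      (contDiff_mode (a₁ := a₁) (a₂ := a₂) 0 0 k) 1) 1) = modeL2 a₁ a₂ 0 2 k :=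
  smoothL2_congr _ _ (by rw [pderiv_one_mode, pderiv_one_mode])

theorem modeL2_two_zero (k : ℕ × ℕ) :
    modeL2 a₁ a₂ 2 0 k = -freq a₁ k.1 ^ 2 • modeL2 a₁ a₂ 0 0 k := by
  rw [modeL2, modeL2, smoothL2, smoothL2, ← MemLp.toLp_const_smul]
  refine MemLp.toLp_congr _ _ (Eventually.of_forall fun ξ => ?_)
  simp only [mode, prodFn, trig_two, Pi.smul_apply, smul_eq_mul]
  ring

theorem modeL2_zero_two (k : ℕ × ℕ) :
    modeL2 a₁ a₂ 0 2 k = -freq a₂ k.2 ^ 2 • modeL2 a₁ a₂ 0 0 k := by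
  rw [modeL2, modeL2, smoothL2, smoothL2, ← MemLp.toLp_const_smul]
  refine MemLp.toLp_congr _ _ (Eventually.of_forall fun ξ => ?_)
  simp only [mode, prodFn, trig_two, Pi.smul_apply, smul_eq_mul]
  ring

theorem State.lap_apply {Ω : Set Plane} (x : State Ω) :
    State.lap x = H1.deriv 0 (State.grad x 0) + H1.deriv 1 (State.grad x 1) := by
  rw [State.lap, Fin.sum_univ_two]
  rfl

theorem inner_State {Ω : Set Plane} (x y : State Ω) :
    inner ℝ x y = inner ℝ x.1.fst y.1.fst +
      (inner ℝ (State.grad x 0) (State.grad y 0) + inner ℝ (State.grad x 1) (State.grad y 1)) := by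
  change inner ℝ x.1 y.1 = _
  rw [WithLp.prod_inner_apply, PiLp.inner_apply, Fin.sum_univ_two]
  rfl

/-- Green's formula for a state and an eigenfunction. -/
theorem inner_modeL2_lap (ha₁ : 0 < a₁) (ha₂ : 0 < a₂) (x : State (Rect a₁ a₂)) (k : ℕ × ℕ) :
    inner ℝ (modeL2 a₁ a₂ 0 0 k) (State.lap x) =
      -eigval a₁ a₂ k * inner ℝ (modeL2 a₁ a₂ 0 0 k) (State.val x) := by
  have hF := contDiff_mode (a₁ := a₁) (a₂ := a₂) 0 0 k
  -- Two integrations by parts: the first uses that the eigenfunction lies in `H¹₀`, the second that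
  -- `x` does.
  have key : ∀ i, inner ℝ (modeL2 a₁ a₂ 0 0 k) (H1.deriv i (State.grad x i)) =
      inner ℝ (smoothL2 a₁ a₂ (contDiff_pderiv (contDiff_pderiv hF i) i)) (State.val x) := by
    intro i
    have h1 := inner_deriv_of_mem_H10 (State.grad x i) (mode_mem_H10 ha₁ ha₂ k) i
    have h2 := inner_deriv_of_mem_H10 (smoothH1 a₁ a₂ (contDiff_pderiv hF i)) x.2.1 i
    have h3 : H1.val (State.grad x i) = H1.deriv i x.1.fst := x.2.2 i
    rw [val_smoothH1, deriv_smoothH1, h3] at h1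
    rw [val_smoothH1, deriv_smoothH1] at h2
    change inner ℝ (smoothL2 a₁ a₂ hF) _ = inner ℝ _ (H1.val x.1.fst)
    rw [h2, real_inner_comm, h1, real_inner_comm]
  rw [State.lap_apply, inner_add_right, key, key, smoothL2_pderiv_zero_pderiv_zero,
    smoothL2_pderiv_one_pderiv_one, modeL2_two_zero, modeL2_zero_two, inner_smul_left,
    inner_smul_left, eigval]
  simp
  ring

/-! ### Completeness of the eigenfunctions -/

/-- The function `cos (π ξᵢ / a)`. -/
def cosFn (a : ℝ) (i : Fin 2) : C(Plane, ℝ) where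
  toFun ξ := Real.cos (freq a 0 * ξ i)
  continuous_toFun := by
    have : Continuous fun ξ : Plane => ξ i :=
      (EuclideanSpace.proj (𝕜 := ℝ) i : Plane →L[ℝ] ℝ).continuous
    fun_prop

/-- The span of the eigenfunctions. -/
def modeSpan (a₁ a₂ : ℝ) : Submodule ℝ (Plane → ℝ) :=
  Submodule.span ℝ (Set.range (mode a₁ a₂ 0 0))

/-- Addition formulas for the sine. The index `n` carries frequency `n + 1`, so for `n = 0` the
lower term would be `sin 0` and drops out. -/
theorem cos_mul_trig (a : ℝ) (n : ℕ) :
    (∀ x, Real.cos (freq a 0 * x) * trig (freq a n) 0 x = (1 / 2) * trig (freq a (n + 1)) 0 x) ∨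
      ∃ n', ∀ x, Real.cos (freq a 0 * x) * trig (freq a n) 0 x =
        (1 / 2) * trig (freq a (n + 1)) 0 x + (1 / 2) * trig (freq a n') 0 x := by
  simp only [trig_zero]
  cases n with
  | zero =>
    left
    intro x
    have : freq a (0 + 1) * x = 2 * (freq a 0 * x) := by
      simp only [freq]; push_cast; ring
    rw [this, Real.sin_two_mul]
    ring
  | succ n =>
    refine Or.inr ⟨n, fun x => ?_⟩
    have h1 : freq a (n + 1 + 1) * x = freq a (n + 1) * x + freq a 0 * x := by
      simp only [freq]; push_cast; ring
    have h2 : freq a n * x = freq a (n + 1) * x - freq a 0 * x := by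
      simp only [freq]; push_cast; ring
    rw [h1, h2, Real.sin_add, Real.sin_sub]
    ring

theorem cosFn_mul_mode_mem (a₁ a₂ : ℝ) (i : Fin 2) (k : ℕ × ℕ) :
    (cosFn (![a₁, a₂] i) i : Plane → ℝ) * mode a₁ a₂ 0 0 k ∈ modeSpan a₁ a₂ := by
  have hm : ∀ k, mode a₁ a₂ 0 0 k ∈ modeSpan a₁ a₂ := fun k => Submodule.subset_span ⟨k, rfl⟩
  fin_cases i
  · rcases cos_mul_trig a₁ k.1 with h | ⟨n', h⟩
    · convert (modeSpan a₁ a₂).smul_mem (1 / 2) (hm (k.1 + 1, k.2)) using 1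
      funext ξ
      simp only [Pi.mul_apply, Pi.smul_apply, smul_eq_mul, mode, prodFn]
      rw [← mul_assoc (1 / 2 : ℝ), ← h, ← mul_assoc]
      rfl
    · convert add_mem ((modeSpan a₁ a₂).smul_mem (1 / 2) (hm (k.1 + 1, k.2)))
        ((modeSpan a₁ a₂).smul_mem (1 / 2) (hm (n', k.2))) using 1
      funext ξ
      simp only [Pi.mul_apply, Pi.smul_apply, Pi.add_apply, smul_eq_mul, mode, prodFn]
      rw [← mul_assoc (1 / 2 : ℝ), ← mul_assoc (1 / 2 : ℝ), ← add_mul, ← h, ← mul_assoc]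
      rfl
  · rcases cos_mul_trig a₂ k.2 with h | ⟨n', h⟩
    · convert (modeSpan a₁ a₂).smul_mem (1 / 2) (hm (k.1, k.2 + 1)) using 1
      funext ξ
      simp only [Pi.mul_apply, Pi.smul_apply, smul_eq_mul, mode, prodFn]
      rw [mul_left_comm (1 / 2 : ℝ), ← h, mul_left_comm]
      rfl
    · convert add_mem ((modeSpan a₁ a₂).smul_mem (1 / 2) (hm (k.1, k.2 + 1)))
        ((modeSpan a₁ a₂).smul_mem (1 / 2) (hm (k.1, n'))) using 1
      funext ξ
      simp only [Pi.mul_apply, Pi.smul_apply, Pi.add_apply, smul_eq_mul, mode, prodFn]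
      rw [mul_left_comm (1 / 2 : ℝ), mul_left_comm (1 / 2 : ℝ), ← mul_add, ← h, mul_left_comm]
      rfl

/-- The algebra generated by the functions `cos (π ξᵢ / aᵢ)`. -/
def cosAlgebra (a₁ a₂ : ℝ) : Subalgebra ℝ C(Plane, ℝ) :=
  Algebra.adjoin ℝ (Set.range fun i : Fin 2 => cosFn (![a₁, a₂] i) i)

/-- The span of the sines is a module over the algebra of cosines, so orthogonality to the span
passes to all products of the first eigenfunction with elements of the algebra. -/
theorem cosAlgebra_mul_mem {p : C(Plane, ℝ)} (hp : p ∈ cosAlgebra a₁ a₂) :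
    ∀ w ∈ modeSpan a₁ a₂, (p : Plane → ℝ) * w ∈ modeSpan a₁ a₂ := by
  refine Algebra.adjoin_induction (p := fun (p : C(Plane, ℝ)) _ =>
    ∀ w ∈ modeSpan a₁ a₂, (p : Plane → ℝ) * w ∈ modeSpan a₁ a₂) ?_ ?_ ?_ ?_ hp
  · rintro _ ⟨i, rfl⟩ w hw
    refine Submodule.span_induction (p := fun w _ =>
      (cosFn (![a₁, a₂] i) i : Plane → ℝ) * w ∈ modeSpan a₁ a₂) ?_ ?_ ?_ ?_ hw
    · rintro _ ⟨k, rfl⟩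
      exact cosFn_mul_mode_mem a₁ a₂ i k
    · simp
    · intro x y _ _ hx hy
      rw [mul_add]
      exact add_mem hx hy
    · intro c x _ hx
      rw [mul_smul_comm]
      exact Submodule.smul_mem _ _ hx
  · intro r w hw
    exact (modeSpan a₁ a₂).smul_mem r hw
  · intro p q _ _ hp hq w hw
    rw [ContinuousMap.coe_add, add_mul]
    exact add_mem (hp w hw) (hq w hw)
  · intro p q _ _ hp hq w hw
    rw [ContinuousMap.coe_mul, mul_assoc]
    exact hp _ (hq w hw)

/-- Stone–Weierstrass on the closed rectangle: `cos (π x / a)` is injective on `[0, a]`, so the two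
generators separate points. -/
theorem exists_mem_cosAlgebra_near (ha₁ : 0 < a₁) (ha₂ : 0 < a₂) {φ : Plane → ℝ}
    (hφ : Continuous φ) {ε : ℝ} (hε : 0 < ε) :
    ∃ p ∈ cosAlgebra a₁ a₂, ∀ ξ ∈ Rect a₁ a₂, |p ξ - φ ξ| < ε := by
  set K : Set Plane := {ξ | ∀ i, ξ i ∈ Icc ((![0, 0] : Fin 2 → ℝ) i) (![a₁, a₂] i)} with hK
  have : CompactSpace K := isCompact_iff_compactSpace.1 (isCompact_box _ _)
  set r : C(K, Plane) := ⟨Subtype.val, continuous_subtype_val⟩ with hr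
  have hsep : ((cosAlgebra a₁ a₂).map (ContinuousMap.compRightAlgHom ℝ ℝ r)).SeparatesPoints := by
    intro x y hxy
    have : ∃ i, (x : Plane) i ≠ (y : Plane) i := by
      by_contra! h
      exact hxy (Subtype.ext (PiLp.ext h))
    obtain ⟨i, hi⟩ := this
    refine ⟨_, ⟨(cosFn (![a₁, a₂] i) i).comp r, ⟨cosFn (![a₁, a₂] i) i,
      Algebra.subset_adjoin ⟨i, rfl⟩, rfl⟩, rfl⟩, ?_⟩
    change Real.cos (freq (![a₁, a₂] i) 0 * (x : Plane) i) ≠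
      Real.cos (freq (![a₁, a₂] i) 0 * (y : Plane) i)
    have hpos : 0 < ![a₁, a₂] i := by fin_cases i <;> assumption
    have hf := freq_pos hpos 0
    have hmem : ∀ z : K, freq (![a₁, a₂] i) 0 * (z : Plane) i ∈ Icc 0 Real.pi := fun z => by
      have h0 := z.2 i
      have h00 : (![0, 0] : Fin 2 → ℝ) i = 0 := by fin_cases i <;> rfl
      rw [h00] at h0
      refine ⟨mul_nonneg hf.le h0.1, ?_⟩
      have := mul_le_mul_of_nonneg_left h0.2 hf.le
      rw [freq_mul hpos] at this
      simpa using this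
    intro h
    exact hi (mul_left_cancel₀ hf.ne' (Real.injOn_cos (hmem x) (hmem y) h))
  obtain ⟨⟨g, hg⟩, hgφ⟩ := ContinuousMap.exists_mem_subalgebra_near_continuous_of_separatesPoints _
    hsep (fun ξ : K => φ ξ) (hφ.comp continuous_subtype_val) ε hε
  obtain ⟨p, hp, rfl⟩ := hg
  exact ⟨p, hp, fun ξ hξ => hgφ ⟨ξ, Rect_subset_box hξ⟩⟩

theorem mode_zero_pos (ha₁ : 0 < a₁) (ha₂ : 0 < a₂) {ξ : Plane} (hξ : ξ ∈ Rect a₁ a₂) :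
    0 < mode a₁ a₂ 0 0 (0, 0) ξ := by
  have h : ∀ {a x : ℝ}, 0 < a → x ∈ Ioo 0 a → 0 < trig (freq a 0) 0 x := fun {a x} ha hx => by
    rw [trig_zero]
    refine Real.sin_pos_of_pos_of_lt_pi (mul_pos (freq_pos ha 0) hx.1) ?_
    have := mul_lt_mul_of_pos_left hx.2 (freq_pos ha 0)
    rw [freq_mul ha] at this
    simpa using this
  exact mul_pos (h ha₁ hξ.1) (h ha₂ hξ.2)

theorem integrable_continuous_mul_L2 {w : Plane → ℝ} (hw : Continuous w) (v : L2 (Rect a₁ a₂)) :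
    Integrable (fun ξ => w ξ * v ξ) (volume.restrict (Rect a₁ a₂)) :=
  (memLp_Rect hw).integrable_mul (Lp.memLp v)

/-- The eigenfunctions are complete in `L²`. -/
theorem eq_zero_of_inner_modeL2 (ha₁ : 0 < a₁) (ha₂ : 0 < a₂) (v : L2 (Rect a₁ a₂))
    (hv : ∀ k, inner ℝ (modeL2 a₁ a₂ 0 0 k) v = 0) : v = 0 := by
  have hspan : ∀ w ∈ modeSpan a₁ a₂, Continuous w ∧ ∫ ξ in Rect a₁ a₂, w ξ * v ξ = 0 := by
    intro w hw
    refine Submodule.span_induction (p := fun w _ =>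
      Continuous w ∧ ∫ ξ in Rect a₁ a₂, w ξ * v ξ = 0) ?_ ?_ ?_ ?_ hw
    · rintro _ ⟨k, rfl⟩
      refine ⟨(contDiff_mode 0 0 k).continuous, ?_⟩
      rw [← hv k, L2.inner_def]
      refine integral_congr_ae ?_
      filter_upwards [smoothL2_coe (a₁ := a₁) (a₂ := a₂) (contDiff_mode 0 0 k)] with ξ hξ
      rw [modeL2, hξ]
      simp [mul_comm]
    · exact ⟨continuous_const, by simp⟩
    · rintro x y _ _ ⟨hx, hx'⟩ ⟨hy, hy'⟩
      refine ⟨hx.add hy, ?_⟩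
      simp only [Pi.add_apply, add_mul]
      rw [integral_add (integrable_continuous_mul_L2 hx v) (integrable_continuous_mul_L2 hy v),
        hx', hy', add_zero]
    · rintro c x _ ⟨hx, hx'⟩
      refine ⟨hx.const_smul c, ?_⟩
      simp only [Pi.smul_apply, smul_eq_mul, mul_assoc]
      rw [integral_const_mul, hx', mul_zero]
  -- The first eigenfunction is positive on the open rectangle, so it suffices that `e * v`
  -- vanishes. That function is orthogonal to the whole cosine algebra.
  set e := mode a₁ a₂ 0 0 (0, 0) with he
  have hec : Continuous e := (contDiff_mode 0 0 _).continuous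
  obtain ⟨M, hM⟩ := exists_bound_on_Rect (a₁ := a₁) (a₂ := a₂) hec
  have hmem := ae_restrict_mem (μ := volume) (isOpen_Rect a₁ a₂).measurableSet
  have hu : MemLp (fun ξ => e ξ * v ξ) 2 (volume.restrict (Rect a₁ a₂)) := by
    refine (Lp.memLp v).of_le_mul (c := M)
      (hec.aestronglyMeasurable.mul (Lp.aestronglyMeasurable v)) (hmem.mono fun ξ hξ => ?_)
    rw [norm_mul]
    exact mul_le_mul_of_nonneg_right (hM ξ hξ) (norm_nonneg _)
  have hint : Integrable (fun ξ => e ξ * v ξ) (volume.restrict (Rect a₁ a₂)) :=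
    integrable_continuous_mul_L2 hec v
  set U : L2 (Rect a₁ a₂) := hu.toLp with hU
  have hu0 : U = 0 := by
    refine eq_zero_of_test (isOpen_Rect a₁ a₂) _ fun φ hφ => ?_
    have h1 : ∫ ξ in Rect a₁ a₂, φ ξ * U ξ = ∫ ξ in Rect a₁ a₂, φ ξ * (e ξ * v ξ) := by
      refine integral_congr_ae ?_
      filter_upwards [hu.coeFn_toLp] with ξ hξ
      rw [hξ]
    rw [h1]
    set I := ∫ ξ in Rect a₁ a₂, |e ξ * v ξ| with hI
    have hbound : ∀ ε > 0, |∫ ξ in Rect a₁ a₂, φ ξ * (e ξ * v ξ)| ≤ ε * I := by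
      intro ε hε
      obtain ⟨p, hp, hpφ⟩ := exists_mem_cosAlgebra_near ha₁ ha₂ hφ.smooth.continuous hε
      have h2 := (hspan _ (cosAlgebra_mul_mem hp e (Submodule.subset_span ⟨_, rfl⟩))).2
      have hi : ∀ {ψ : Plane → ℝ}, Continuous ψ →
          Integrable (fun ξ => ψ ξ * (e ξ * v ξ)) (volume.restrict (Rect a₁ a₂)) := fun hψ => by
        have := integrable_continuous_mul_L2 (hψ.mul hec) v
        simpa only [Pi.mul_apply, mul_assoc] using this
      have h3 : ∫ ξ in Rect a₁ a₂, φ ξ * (e ξ * v ξ) =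
          ∫ ξ in Rect a₁ a₂, (φ ξ * (e ξ * v ξ) - p ξ * (e ξ * v ξ)) := by
        rw [integral_sub (hi hφ.smooth.continuous) (hi p.continuous)]
        simp only [Pi.mul_apply, mul_assoc] at h2
        rw [h2, sub_zero]
      rw [h3, hI, ← integral_const_mul, ← Real.norm_eq_abs]
      refine norm_integral_le_of_norm_le (hint.abs.const_mul ε) (hmem.mono fun ξ hξ => ?_)
      rw [← sub_mul, norm_mul, norm_sub_rev]
      exact mul_le_mul_of_nonneg_right (hpφ ξ hξ).le (norm_nonneg _)
    have hI0 : 0 ≤ I := integral_nonneg fun ξ => abs_nonneg _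
    refine abs_eq_zero.1 (le_antisymm (le_of_forall_pos_le_add fun δ hδ => ?_) (abs_nonneg _))
    -- The summand `1` guards against `I = 0`.
    refine (hbound (δ / (I + 1)) (by positivity)).trans ?_
    rw [zero_add, div_mul_eq_mul_div, div_le_iff₀ (by positivity)]
    nlinarith
  rw [Lp.eq_zero_iff_ae_eq_zero] at hu0 ⊢
  filter_upwards [hu0, hu.coeFn_toLp, hmem] with ξ h1 h2 h3
  rw [h2] at h1
  exact (mul_eq_zero.1 h1).resolve_left (mode_zero_pos ha₁ ha₂ h3).ne'

end Eigenfunctions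

section SpectralBasis

variable {a₁ a₂ : ℝ}

/-! ### The eigenfunction basis of the state space -/

/-- The constant which normalizes the eigenfunctions in `L²`. -/
def modeScale (a₁ a₂ : ℝ) : ℝ := √(4 / (a₁ * a₂))

theorem modeScale_mul_self (ha₁ : 0 < a₁) (ha₂ : 0 < a₂) :
    modeScale a₁ a₂ * modeScale a₁ a₂ * (a₁ * a₂ / 4) = 1 := by
  rw [modeScale, Real.mul_self_sqrt (by positivity)]
  field_simp

theorem modeScale_pos (ha₁ : 0 < a₁) (ha₂ : 0 < a₂) : 0 < modeScale a₁ a₂ :=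
  Real.sqrt_pos.2 (by positivity)

theorem orthonormal_modeL2 (ha₁ : 0 < a₁) (ha₂ : 0 < a₂) :
    Orthonormal ℝ fun k => modeScale a₁ a₂ • modeL2 a₁ a₂ 0 0 k := by
  rw [orthonormal_iff_ite]
  intro k l
  rw [real_inner_smul_left, real_inner_smul_right, inner_modeL2 ha₁ ha₂]
  split_ifs
  · rw [← mul_assoc]
    simpa using modeScale_mul_self ha₁ ha₂
  · simp

/-- The Hilbert basis of `L²` consisting of eigenfunctions. -/
def basisL2 (ha₁ : 0 < a₁) (ha₂ : 0 < a₂) : HilbertBasis (ℕ × ℕ) ℝ (L2 (Rect a₁ a₂)) :=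
  HilbertBasis.mkOfOrthogonalEqBot (orthonormal_modeL2 ha₁ ha₂) (by
    rw [Submodule.eq_bot_iff]
    intro v hv
    refine eq_zero_of_inner_modeL2 ha₁ ha₂ v fun k => ?_
    have h := (Submodule.mem_orthogonal _ v).1 hv _ (Submodule.subset_span ⟨k, rfl⟩)
    rw [real_inner_smul_left] at h
    exact (mul_eq_zero.1 h).resolve_left (modeScale_pos ha₁ ha₂).ne')

theorem basisL2_apply (ha₁ : 0 < a₁) (ha₂ : 0 < a₂) (k : ℕ × ℕ) :
    basisL2 ha₁ ha₂ k = modeScale a₁ a₂ • modeL2 a₁ a₂ 0 0 k := by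
  rw [basisL2, HilbertBasis.coe_mkOfOrthogonalEqBot]

/-- The eigenfunctions as states. -/
def modeState (ha₁ : 0 < a₁) (ha₂ : 0 < a₂) (k : ℕ × ℕ) : State (Rect a₁ a₂) :=
  ⟨WithLp.toLp 2 (smoothH1 a₁ a₂ (contDiff_mode (a₁ := a₁) (a₂ := a₂) 0 0 k),
    WithLp.toLp 2 fun i =>
      smoothH1 a₁ a₂ (contDiff_pderiv (contDiff_mode (a₁ := a₁) (a₂ := a₂) 0 0 k) i)),
    mode_mem_H10 ha₁ ha₂ k, fun _ => rfl⟩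

theorem val_modeState (ha₁ : 0 < a₁) (ha₂ : 0 < a₂) (k : ℕ × ℕ) :
    State.val (modeState ha₁ ha₂ k) = modeL2 a₁ a₂ 0 0 k := rfl

theorem lap_modeState (ha₁ : 0 < a₁) (ha₂ : 0 < a₂) (k : ℕ × ℕ) :
    State.lap (modeState ha₁ ha₂ k) = -eigval a₁ a₂ k • modeL2 a₁ a₂ 0 0 k := by
  have h : ∀ i, H1.deriv i (State.grad (modeState ha₁ ha₂ k) i) =
      smoothL2 a₁ a₂ (contDiff_pderiv (contDiff_pderiv (contDiff_mode 0 0 k) i) i) :=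
    fun _ => rfl
  rw [State.lap_apply, h, h, smoothL2_pderiv_zero_pderiv_zero, smoothL2_pderiv_one_pderiv_one, modeL2_two_zero,
    modeL2_zero_two, eigval, neg_add, add_smul]

/-- The norm counts each first derivative twice and the mixed second derivative twice, so the
squared frequencies add up to `1 + 2λ + λ² = (1 + λ)²`. Hence `1 - Δ` preserves the norms of the
eigenfunctions. -/
theorem inner_modeState (ha₁ : 0 < a₁) (ha₂ : 0 < a₂) (k l : ℕ × ℕ) :
    inner ℝ (modeState ha₁ ha₂ k) (modeState ha₁ ha₂ l) =
      if k = l then (1 + eigval a₁ a₂ k) ^ 2 * (a₁ * a₂ / 4) else 0 := by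
  have hs : ∀ {F : ℕ × ℕ → Plane → ℝ} (m₁ m₂ : ℕ) (hF : ∀ k, ContDiff ℝ (⊤ : ℕ∞) (F k)),
      (∀ k, F k = mode a₁ a₂ m₁ m₂ k) →
      inner ℝ (smoothL2 a₁ a₂ (hF k)) (smoothL2 a₁ a₂ (hF l)) =
        if k = l then freq a₁ k.1 ^ (2 * m₁) * freq a₂ k.2 ^ (2 * m₂) * (a₁ * a₂ / 4) else 0 := by
    intro F m₁ m₂ hF h
    rw [← inner_modeL2 ha₁ ha₂, smoothL2_congr (hF k) (contDiff_mode m₁ m₂ k) (h k),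
      smoothL2_congr (hF l) (contDiff_mode m₁ m₂ l) (h l)]
    rfl
  rw [inner_State]
  change inner ℝ (smoothH1 a₁ a₂ _) (smoothH1 a₁ a₂ _) +
    (inner ℝ (smoothH1 a₁ a₂ _) (smoothH1 a₁ a₂ _) +
      inner ℝ (smoothH1 a₁ a₂ _) (smoothH1 a₁ a₂ _)) = _
  simp only [inner_H1, val_smoothH1, deriv_smoothH1]
  rw [hs (F := fun k => mode a₁ a₂ 0 0 k) 0 0 (contDiff_mode 0 0) fun _ => rfl,
    hs (F := fun k => pderiv 0 (mode a₁ a₂ 0 0 k)) 1 0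
      (fun k => contDiff_pderiv (contDiff_mode 0 0 k) 0) fun _ => pderiv_zero_mode _ _ _,
    hs (F := fun k => pderiv 1 (mode a₁ a₂ 0 0 k)) 0 1
      (fun k => contDiff_pderiv (contDiff_mode 0 0 k) 1) fun _ => pderiv_one_mode _ _ _,
    hs (F := fun k => pderiv 0 (pderiv 0 (mode a₁ a₂ 0 0 k))) 2 0
      (fun k => contDiff_pderiv (contDiff_pderiv (contDiff_mode 0 0 k) 0) 0)
      fun _ => by rw [pderiv_zero_mode, pderiv_zero_mode],
    hs (F := fun k => pderiv 1 (pderiv 0 (mode a₁ a₂ 0 0 k))) 1 1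
      (fun k => contDiff_pderiv (contDiff_pderiv (contDiff_mode 0 0 k) 0) 1)
      fun _ => by rw [pderiv_zero_mode, pderiv_one_mode],
    hs (F := fun k => pderiv 0 (pderiv 1 (mode a₁ a₂ 0 0 k))) 1 1
      (fun k => contDiff_pderiv (contDiff_pderiv (contDiff_mode 0 0 k) 1) 0)
      fun _ => by rw [pderiv_one_mode, pderiv_zero_mode],
    hs (F := fun k => pderiv 1 (pderiv 1 (mode a₁ a₂ 0 0 k))) 0 2
      (fun k => contDiff_pderiv (contDiff_pderiv (contDiff_mode 0 0 k) 1) 1)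
      fun _ => by rw [pderiv_one_mode, pderiv_one_mode]]
  split_ifs
  · rw [eigval]
    ring
  · simp

theorem one_add_eigval_pos (ha₁ : 0 < a₁) (k : ℕ × ℕ) : 0 < 1 + eigval a₁ a₂ k := by
  have := eigval_pos (a₂ := a₂) ha₁ k
  linarith

/-- The coefficients which normalize the eigenfunctions in the state space. -/
def stateScale (a₁ a₂ : ℝ) (k : ℕ × ℕ) : ℝ := modeScale a₁ a₂ / (1 + eigval a₁ a₂ k)

theorem orthonormal_modeState (ha₁ : 0 < a₁) (ha₂ : 0 < a₂) :
    Orthonormal ℝ fun k => stateScale a₁ a₂ k • modeState ha₁ ha₂ k := by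
  rw [orthonormal_iff_ite]
  intro k l
  rw [real_inner_smul_left, real_inner_smul_right, inner_modeState ha₁ ha₂]
  split_ifs with h
  · subst h
    have h1 := (one_add_eigval_pos (a₂ := a₂) ha₁ k).ne'
    refine Eq.trans ?_ (modeScale_mul_self ha₁ ha₂)
    rw [stateScale]
    field_simp
  · simp

/-- The operator `1 - Δ` from the state space to `L²`. -/
def oneSubLap (Ω : Set Plane) : State Ω →L[ℝ] L2 Ω := State.val - State.lap

theorem oneSubLap_modeState (ha₁ : 0 < a₁) (ha₂ : 0 < a₂) (k : ℕ × ℕ) :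
    oneSubLap _ (stateScale a₁ a₂ k • modeState ha₁ ha₂ k) = basisL2 ha₁ ha₂ k := by
  have h1 := (one_add_eigval_pos (a₂ := a₂) ha₁ k).ne'
  rw [basisL2_apply, oneSubLap, _root_.sub_apply, map_smul, map_smul, val_modeState,
    lap_modeState, ← smul_sub, neg_smul, sub_neg_eq_add,
    show modeL2 a₁ a₂ 0 0 k + eigval a₁ a₂ k • modeL2 a₁ a₂ 0 0 k =
      (1 + eigval a₁ a₂ k) • modeL2 a₁ a₂ 0 0 k by rw [add_smul, one_smul], smul_smul,
    stateScale, div_mul_cancel₀ _ h1]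

theorem inner_basisL2_oneSubLap (ha₁ : 0 < a₁) (ha₂ : 0 < a₂) (x : State (Rect a₁ a₂))
    (k : ℕ × ℕ) : inner ℝ (basisL2 ha₁ ha₂ k) (oneSubLap _ x) =
      (1 + eigval a₁ a₂ k) * inner ℝ (basisL2 ha₁ ha₂ k) (State.val x) := by
  rw [basisL2_apply, oneSubLap, _root_.sub_apply, inner_sub_right,
    real_inner_smul_left, real_inner_smul_left, inner_modeL2_lap ha₁ ha₂]
  ring

/-- By Green's formula, `1 - Δ` multiplies the `k`-th sine coefficient by the nonzero number `1 +
eigval`. -/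
theorem oneSubLap_injective (ha₁ : 0 < a₁) (ha₂ : 0 < a₂) {x y : State (Rect a₁ a₂)}
    (h : oneSubLap _ x = oneSubLap _ y) : x = y := by
  refine State.val_injective (isOpen_Rect a₁ a₂) (hilbertBasis_ext (basisL2 ha₁ ha₂) fun k => ?_)
  rw [HilbertBasis.repr_apply_apply, HilbertBasis.repr_apply_apply]
  refine mul_left_cancel₀ (one_add_eigval_pos (a₂ := a₂) ha₁ k).ne' ?_
  have h1 := inner_basisL2_oneSubLap ha₁ ha₂ x k
  rw [h, inner_basisL2_oneSubLap] at h1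
  exact h1.symm

/-- The `L²` coefficients of `(1 - Δ)x` are square summable, so the series converges in the state
space. Its sum has the same image under `1 - Δ` as `x`, and injectivity identifies the two. -/
theorem hasSum_modeState (ha₁ : 0 < a₁) (ha₂ : 0 < a₂) (x : State (Rect a₁ a₂)) :
    HasSum (fun k => (basisL2 ha₁ ha₂).repr (oneSubLap _ x) k •
      (stateScale a₁ a₂ k • modeState ha₁ ha₂ k)) x := by
  set d := (basisL2 ha₁ ha₂).repr (oneSubLap _ x) with hd
  have h1 := (orthonormal_modeState ha₁ ha₂).orthogonalFamily.hasSum_linearIsometry d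
  simp only [LinearIsometry.toSpanSingleton_apply] at h1
  convert h1
  refine oneSubLap_injective ha₁ ha₂ ?_
  have h2 := h1.mapL (oneSubLap _)
  simp only [map_smul _ (d _), oneSubLap_modeState] at h2
  exact ((basisL2 ha₁ ha₂).hasSum_repr _).unique h2

theorem top_le_closure_span_modeState (ha₁ : 0 < a₁) (ha₂ : 0 < a₂) :
    ⊤ ≤ (Submodule.span ℝ (Set.range fun k =>
      stateScale a₁ a₂ k • modeState ha₁ ha₂ k)).topologicalClosure := by
  intro x _
  refine mem_closure_of_tendsto (hasSum_modeState ha₁ ha₂ x) (Eventually.of_forall fun s => ?_)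
  exact sum_mem fun k _ => Submodule.smul_mem _ _ (Submodule.subset_span ⟨k, rfl⟩)

/-- The Hilbert basis of the state space consisting of eigenfunctions. -/
def basisState (ha₁ : 0 < a₁) (ha₂ : 0 < a₂) : HilbertBasis (ℕ × ℕ) ℝ (State (Rect a₁ a₂)) :=
  HilbertBasis.mk (orthonormal_modeState ha₁ ha₂) (top_le_closure_span_modeState ha₁ ha₂)

theorem basisState_apply (ha₁ : 0 < a₁) (ha₂ : 0 < a₂) (k : ℕ × ℕ) :
    basisState ha₁ ha₂ k = stateScale a₁ a₂ k • modeState ha₁ ha₂ k := by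
  rw [basisState, HilbertBasis.coe_mk]

theorem repr_basisState (ha₁ : 0 < a₁) (ha₂ : 0 < a₂) (x : State (Rect a₁ a₂)) (k : ℕ × ℕ) :
    (basisState ha₁ ha₂).repr x k =
      (1 + eigval a₁ a₂ k) * inner ℝ (basisL2 ha₁ ha₂ k) (State.val x) := by
  rw [← inner_basisL2_oneSubLap]
  have h1 := (((basisState ha₁ ha₂).hasSum_repr x).mapL (oneSubLap _)).mapL
    (innerSL ℝ (basisL2 ha₁ ha₂ k))
  have h2 : ∀ l, innerSL ℝ (basisL2 ha₁ ha₂ k) (oneSubLap _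
      ((basisState ha₁ ha₂).repr x l • basisState ha₁ ha₂ l)) =
      if l = k then (basisState ha₁ ha₂).repr x k else 0 := fun l => by
    rw [map_smul, map_smul, basisState_apply, oneSubLap_modeState, innerSL_apply_apply,
      orthonormal_iff_ite.1 (basisL2 ha₁ ha₂).orthonormal]
    rcases eq_or_ne l k with rfl | hl
    · simp
    · simp [hl, hl.symm]
  simp only [h2] at h1
  exact (hasSum_ite_eq k _).unique h1

/-! ### Spectral form of the Dirichlet Laplacian and the resulting observers. -/

theorem mem_graph_dirichletLaplacian {Ω : Set Plane} (hΩ : IsOpen Ω) (x y : State Ω) :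
    (x, y) ∈ (dirichletLaplacian hΩ).graph ↔ State.val y = State.lap x := by
  rw [LinearPMap.mem_graph_iff]
  constructor
  · rintro ⟨w, rfl, rfl⟩
    exact dirichletLaplacian_val hΩ w
  · intro h
    have hx : x ∈ (dirichletLaplacian hΩ).domain := ⟨y, h⟩
    refine ⟨⟨x, hx⟩, rfl, State.val_injective hΩ ?_⟩
    exact (dirichletLaplacian_val hΩ ⟨x, hx⟩).trans h.symm

/-- The Dirichlet Laplacian is diagonal in the basis of eigenfunctions. -/
theorem mem_graph_dirichletLaplacian_iff_repr (ha₁ : 0 < a₁) (ha₂ : 0 < a₂)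
    (x y : State (Rect a₁ a₂)) :
    (x, y) ∈ (dirichletLaplacian (isOpen_Rect a₁ a₂)).graph ↔
      ∀ k, (basisState ha₁ ha₂).repr y k = -eigval a₁ a₂ k * (basisState ha₁ ha₂).repr x k := by
  rw [mem_graph_dirichletLaplacian]
  have hlap : ∀ k, inner ℝ (basisL2 ha₁ ha₂ k) (State.lap x) =
      -eigval a₁ a₂ k * inner ℝ (basisL2 ha₁ ha₂ k) (State.val x) := fun k => by
    rw [basisL2_apply, real_inner_smul_left, real_inner_smul_left, inner_modeL2_lap ha₁ ha₂]
    ring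
  constructor
  · intro h k
    rw [repr_basisState, repr_basisState, h, hlap]
    ring
  · intro h
    refine hilbertBasis_ext (basisL2 ha₁ ha₂) fun k => ?_
    rw [HilbertBasis.repr_apply_apply, HilbertBasis.repr_apply_apply, hlap]
    have h1 := h k
    rw [repr_basisState, repr_basisState] at h1
    refine mul_left_cancel₀ (one_add_eigval_pos (a₂ := a₂) ha₁ k).ne' ?_
    rw [h1]
    ring

theorem observerExists (ha₁ : 0 < a₁) (ha₂ : 0 < a₂) {ω : Set Plane} (hω : ω ⊆ Rect a₁ a₂)
    (C : State (Rect a₁ a₂) →L[ℝ] ℝ) : ObserverExists hω C := by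
  have hA := mem_graph_dirichletLaplacian_iff_repr ha₁ ha₂
  -- The lowest frequency in the first variable already gives a positive lower bound for the
  -- spectrum of `-Δ`.
  have hc : ∀ k, freq a₁ 0 ^ 2 ≤ eigval a₁ a₂ k := fun k => by
    have h1 : freq a₁ 0 ≤ freq a₁ k.1 := by
      have := Real.pi_pos
      unfold freq
      gcongr
      exact Nat.zero_le _
    have h2 : freq a₁ 0 ^ 2 ≤ freq a₁ k.1 ^ 2 := pow_le_pow_left₀ (freq_pos ha₁ 0).le h1 2
    exact h2.trans (le_add_of_nonneg_right (sq_nonneg _))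
  refine ⟨exists_stabilizing_gain _ (pow_pos (freq_pos ha₁ 0) 2) hc hA _ C, fun H hH p B => ?_⟩
  exact isGradObserver_closedLoop _
    (generates_diagSemigroup _ (fun k => eigval_pos ha₁ k) hA)
    (dense_domain_of_diagonal _ hA) B C H hH

/-! ### Continuous representatives -/

/-- From `1 + λ ≥ 2 f₁ f₂`, with `f₁`, `f₂` the two frequencies, `stateScale` is at most a constant
times `1 / ((k₁ + 1)(k₂ + 1))`. This is the summability behind the embedding of `H²` into continuous
functions in dimension two. -/
theorem summable_stateScale_sq (ha₁ : 0 < a₁) (ha₂ : 0 < a₂) :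
    Summable fun k => stateScale a₁ a₂ k ^ 2 := by
  have h1 : Summable fun n : ℕ => 1 / ((n : ℝ) + 1) ^ 2 := by
    have := (summable_nat_add_iff 1).2 (Real.summable_one_div_nat_pow.2 one_lt_two)
    simpa using this
  have h2 := h1.mul_of_nonneg h1 (fun n => by positivity) (fun n => by positivity)
  set q := modeScale a₁ a₂ * (a₁ * a₂) / (2 * Real.pi ^ 2) with hq
  refine Summable.of_nonneg_of_le (fun k => sq_nonneg _) (fun k => ?_) (h2.mul_left (q ^ 2))
  have hpi := Real.pi_pos
  have hs := modeScale_pos ha₁ ha₂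
  have h3 : 2 * (freq a₁ k.1 * freq a₂ k.2) ≤ 1 + eigval a₁ a₂ k := by
    rw [eigval]
    nlinarith [sq_nonneg (freq a₁ k.1 - freq a₂ k.2)]
  have h4 : 0 < 2 * (freq a₁ k.1 * freq a₂ k.2) := by
    have := mul_pos (freq_pos ha₁ k.1) (freq_pos ha₂ k.2)
    linarith
  have h5 : stateScale a₁ a₂ k ≤ q * (1 / ((k.1 : ℝ) + 1) * (1 / ((k.2 : ℝ) + 1))) := by
    refine (div_le_div_of_nonneg_left hs.le h4 h3).trans (le_of_eq ?_)
    rw [hq, freq, freq]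
    field_simp
  have h6 : 0 ≤ stateScale a₁ a₂ k := div_nonneg hs.le (h4.le.trans h3)
  refine (pow_le_pow_left₀ h6 h5 2).trans (le_of_eq ?_)
  rw [mul_pow, mul_pow, one_div_pow, one_div_pow]

theorem abs_mode_le (k : ℕ × ℕ) (ξ : Plane) : |mode a₁ a₂ 0 0 k ξ| ≤ 1 := by
  rw [mode, prodFn, trig_zero, trig_zero, abs_mul]
  exact mul_le_one₀ (Real.abs_sin_le_one _) (abs_nonneg _) (Real.abs_sin_le_one _)

/-- The eigenfunctions as bounded continuous functions. -/
def modeBCF (a₁ a₂ : ℝ) (k : ℕ × ℕ) : BoundedContinuousFunction Plane ℝ :=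
  BoundedContinuousFunction.ofNormedAddCommGroup (mode a₁ a₂ 0 0 k)
    (contDiff_mode 0 0 k).continuous 1 (abs_mode_le k)

theorem norm_modeBCF_le (k : ℕ × ℕ) : ‖modeBCF a₁ a₂ k‖ ≤ 1 :=
  BoundedContinuousFunction.norm_ofNormedAddCommGroup_le _ zero_le_one _

/-- The terms of the eigenfunction expansion of a state. -/
def repTerm (ha₁ : 0 < a₁) (ha₂ : 0 < a₂) (x : State (Rect a₁ a₂)) (k : ℕ × ℕ) :
    BoundedContinuousFunction Plane ℝ :=
  ((basisState ha₁ ha₂).repr x k * stateScale a₁ a₂ k) • modeBCF a₁ a₂ k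

theorem norm_repTerm_le (ha₁ : 0 < a₁) (ha₂ : 0 < a₂) (x : State (Rect a₁ a₂)) (k : ℕ × ℕ) :
    ‖repTerm ha₁ ha₂ x k‖ ≤ |(basisState ha₁ ha₂).repr x k| * |stateScale a₁ a₂ k| := by
  rw [repTerm, norm_smul, Real.norm_eq_abs, abs_mul]
  exact mul_le_of_le_one_right (by positivity) (norm_modeBCF_le k)

/-- Cauchy–Schwarz. It yields both the uniform convergence of the expansion and the operator bound
for `contRep`. -/
theorem summable_abs_repr_mul (ha₁ : 0 < a₁) (ha₂ : 0 < a₂) (x : State (Rect a₁ a₂)) :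
    (Summable fun k => |(basisState ha₁ ha₂).repr x k| * |stateScale a₁ a₂ k|) ∧
      ∑' k, |(basisState ha₁ ha₂).repr x k| * |stateScale a₁ a₂ k| ≤
        ‖x‖ * √(∑' k, stateScale a₁ a₂ k ^ 2) := by
  have h1 := hasSum_sq_repr (basisState ha₁ ha₂) x
  have h2 := summable_stateScale_sq ha₁ ha₂
  have h := Real.summable_and_inner_le_Lp_mul_Lq_tsum_of_nonneg (p := 2) (q := 2)
    (f := fun k => |(basisState ha₁ ha₂).repr x k|) (g := fun k => |stateScale a₁ a₂ k|)
    (by constructor <;> norm_num) (fun _ => abs_nonneg _) (fun _ => abs_nonneg _)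
    (by simpa using h1.summable) (by simpa using h2)
  refine ⟨h.1, h.2.trans (le_of_eq ?_)⟩
  simp only [Real.rpow_two, sq_abs, h1.tsum_eq]
  rw [← Real.sqrt_eq_rpow, ← Real.sqrt_eq_rpow, Real.sqrt_sq (norm_nonneg _)]

theorem summable_repTerm (ha₁ : 0 < a₁) (ha₂ : 0 < a₂) (x : State (Rect a₁ a₂)) :
    Summable (repTerm ha₁ ha₂ x) :=
  Summable.of_norm_bounded (summable_abs_repr_mul ha₁ ha₂ x).1 (norm_repTerm_le ha₁ ha₂ x)

/-- The continuous representative of a state, as a bounded operator. -/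
def contRep (ha₁ : 0 < a₁) (ha₂ : 0 < a₂) :
    State (Rect a₁ a₂) →L[ℝ] BoundedContinuousFunction Plane ℝ :=
  LinearMap.mkContinuous
    { toFun := fun x => ∑' k, repTerm ha₁ ha₂ x k
      map_add' := fun x y => by
        rw [← (summable_repTerm ha₁ ha₂ x).tsum_add (summable_repTerm ha₁ ha₂ y)]
        refine tsum_congr fun k => ?_
        rw [repTerm, repTerm, repTerm, map_add, lp.coeFn_add, Pi.add_apply, add_mul, add_smul]
      map_smul' := fun c x => by
        rw [RingHom.id_apply, ← (summable_repTerm ha₁ ha₂ x).tsum_const_smul]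
        refine tsum_congr fun k => ?_
        rw [repTerm, repTerm, map_smul, lp.coeFn_smul, Pi.smul_apply, smul_eq_mul, smul_smul,
          mul_assoc] }
    (√(∑' k, stateScale a₁ a₂ k ^ 2)) (fun x => by
      rw [mul_comm]
      have h := summable_abs_repr_mul ha₁ ha₂ x
      exact (tsum_of_norm_bounded h.1.hasSum (norm_repTerm_le ha₁ ha₂ x)).trans h.2)

/-- On a set of finite measure, uniform convergence implies `L²` convergence, so the uniform sum and
the expansion of `x` in the state space have the same image in `L²`. -/
theorem isContinuousRep_contRep (ha₁ : 0 < a₁) (ha₂ : 0 < a₂) (x : State (Rect a₁ a₂)) :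
    IsContinuousRep x (contRep ha₁ ha₂ x) := by
  refine ⟨(contRep ha₁ ha₂ x).continuous.continuousOn, ?_⟩
  let J : BoundedContinuousFunction Plane ℝ →L[ℝ] L2 (Rect a₁ a₂) :=
    BoundedContinuousFunction.toLp 2 (volume.restrict (Rect a₁ a₂)) ℝ
  have h1 : HasSum (fun k => J (repTerm ha₁ ha₂ x k)) (J (contRep ha₁ ha₂ x)) :=
    (summable_repTerm ha₁ ha₂ x).hasSum.mapL J
  have h2 := ((basisState ha₁ ha₂).hasSum_repr x).mapL (State.val (Ω := Rect a₁ a₂))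
  have h3 : ∀ k, State.val ((basisState ha₁ ha₂).repr x k • basisState ha₁ ha₂ k) =
      J (repTerm ha₁ ha₂ x k) := by
    intro k
    have h4 : J (modeBCF a₁ a₂ k) = modeL2 a₁ a₂ 0 0 k := rfl
    rw [repTerm, map_smul, map_smul, basisState_apply, map_smul, val_modeState, smul_smul, h4]
  simp only [h3] at h2
  rw [h2.unique h1]
  exact BoundedContinuousFunction.coeFn_toLp 2 (volume.restrict (Rect a₁ a₂)) ℝ _

/-! ### Sensors as bounded functionals of the continuous representative. -/

theorem exists_pointSensor (ha₁ : 0 < a₁) (ha₂ : 0 < a₂) (b : Plane) :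
    ∃ C : State (Rect a₁ a₂) →L[ℝ] ℝ, IsPointSensor b C :=
  ⟨(BoundedContinuousFunction.evalCLM ℝ b).comp (contRep ha₁ ha₂),
    fun x => ⟨contRep ha₁ ha₂ x, isContinuousRep_contRep ha₁ ha₂ x, rfl⟩⟩

/-- Integration against an integrable density is bounded by `∫ |f|` in the supremum norm, and
composing with `contRep` makes it bounded on states. -/
theorem exists_filamentSensor (ha₁ : 0 < a₁) (ha₂ : 0 < a₂) {σ : Set Plane} {f : Plane → ℝ}
    (hf : IntegrableOn f σ (Measure.hausdorffMeasure 1)) :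
    ∃ C : State (Rect a₁ a₂) →L[ℝ] ℝ, IsFilamentSensor σ f C := by
  have hi : ∀ g : BoundedContinuousFunction Plane ℝ,
      Integrable (fun ξ => g ξ * f ξ) ((Measure.hausdorffMeasure 1).restrict σ) := fun g =>
    Integrable.bdd_mul hf g.continuous.aestronglyMeasurable
      (Eventually.of_forall fun ξ => g.norm_coe_le_norm ξ)
  let I : BoundedContinuousFunction Plane ℝ →L[ℝ] ℝ := LinearMap.mkContinuous
    { toFun := fun g => ∫ ξ in σ, g ξ * f ξ ∂(Measure.hausdorffMeasure 1)
      map_add' := fun g h => by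
        rw [← integral_add (hi g) (hi h)]
        simp only [BoundedContinuousFunction.coe_add, Pi.add_apply, add_mul]
      map_smul' := fun c g => by
        rw [RingHom.id_apply, smul_eq_mul, ← integral_const_mul]
        simp only [BoundedContinuousFunction.coe_smul, smul_eq_mul, mul_assoc] }
    (∫ ξ in σ, ‖f ξ‖ ∂(Measure.hausdorffMeasure 1)) (fun g => by
      rw [mul_comm, ← integral_const_mul]
      refine norm_integral_le_of_norm_le (hf.norm.const_mul _) (Eventually.of_forall fun ξ => ?_)
      rw [norm_mul]
      exact mul_le_mul_of_nonneg_right (g.norm_coe_le_norm ξ) (norm_nonneg _))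
  exact ⟨I.comp (contRep ha₁ ha₂),
    fun x => ⟨contRep ha₁ ha₂ x, isContinuousRep_contRep ha₁ ha₂ x, rfl⟩⟩

end SpectralBasis

end RegionalObserver

end

open RegionalObserver in
theorem corollary5p3 (a₁ a₂ : ℝ) (ha₁ : 0 < a₁) (ha₂ : 0 < a₂)
    (ω : Set Plane) (hωo : IsOpen ω) (hωn : ω.Nonempty) (hω : ω ⊆ Rect a₁ a₂)
    (J : ℕ) (b : Plane) :
    -- internal pointwise sensor at `b`
    (b ∈ Rect a₁ a₂ →
      (∀ i ∈ Finset.Icc 1 J, ∀ n : ℕ, (i : ℝ) * b 0 / a₁ ≠ n) →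
      (∀ j ∈ Finset.Icc 1 J, ∀ n : ℕ, (j : ℝ) * b 1 / a₂ ≠ n) →
      ∃ C : State (Rect a₁ a₂) →L[ℝ] ℝ, IsPointSensor b C ∧ ObserverExists hω C) ∧
    -- filament sensor, symmetric about `b`
    (∀ (γ : ℝ → Plane) (f : Plane → ℝ), ContDiffOn ℝ 1 γ (Set.Icc 0 1) →
      γ '' Set.Icc 0 1 ⊆ closure (Rect a₁ a₂) →
      IsSymmetricAbout b (γ '' Set.Icc 0 1) →
      MeasureTheory.IntegrableOn f (γ '' Set.Icc 0 1) (MeasureTheory.Measure.hausdorffMeasure 1) →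
      (∀ i ∈ Finset.Icc 1 J, ∀ n : ℕ, (i : ℝ) * b 0 / a₁ ≠ n) →
      (∀ j ∈ Finset.Icc 1 J, ∀ n : ℕ, (j : ℝ) * b 1 / a₂ ≠ n) →
      ∃ C : State (Rect a₁ a₂) →L[ℝ] ℝ,
        IsFilamentSensor (γ '' Set.Icc 0 1) f C ∧ ObserverExists hω C) ∧
    -- pointwise sensor at a boundary point `b`
    (b ∈ frontier (Rect a₁ a₂) →
      (∀ j ∈ Finset.Icc 1 J, ∀ n : ℕ, (j : ℝ) * b 1 / a₂ ≠ n) →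
      ∃ C : State (Rect a₁ a₂) →L[ℝ] ℝ, IsPointSensor b C ∧ ObserverExists hω C) := by
  -- The representative lives on the whole plane, so interior and boundary points are evaluated
  -- alike; once `C` is bounded, `observerExists` covers every case.
  refine ⟨fun _ _ _ => ?_, fun γ f _ _ _ hf _ _ => ?_, fun _ _ => ?_⟩
  · obtain ⟨C, hC⟩ := exists_pointSensor ha₁ ha₂ b
    exact ⟨C, hC, observerExists ha₁ ha₂ hω C⟩
  · obtain ⟨C, hC⟩ := exists_filamentSensor ha₁ ha₂ hf
    exact ⟨C, hC, observerExists ha₁ ha₂ hω C⟩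
  · obtain ⟨C, hC⟩ := exists_pointSensor ha₁ ha₂ b
    exact ⟨C, hC, observerExists ha₁ ha₂ hω C⟩
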